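/- **Setting.** Two nodes share a slotted channel. In each slot node $k$ with a non-empty queue transmits with probability $p_k\in(0,1)$ (no backoff, i.e. cutoff stage $K=0$), independently of everything else; a transmission succeeds iff the other node is silent, and the packet then leaves. After that, a new packet arrives at node $k$ with probability $\lambda_k\in(0,1)$, independently. The *exact stability region* is the set of $(\lambda_1,\lambda_2)\in(0,1)^2$ for which the Markov chain $(q_1,q_2)$ of the queue lengths has a stationary distribution. **Approximate model.** For $\{i,j\}=\{1,2\}$, the chain $MC_i$ has states $(q_i,\hat q_j)$ with $\hat q_j=I(q_j>0)$; it moves like the network, except that a success of node $j$ empties its queue (before the arrivals of the slot) with probability $z_j$, where $z_j=P(q_j=1\mid q_j\ge 1)$. Let $A=A_0+A_1+A_2$ be the $2\times2$ matrix of the transition probabilities of $\hat q_j$ in levels $q_i\ge 2$, $\alpha$ its stationary probability vector (entries: $\hat q_j=0$, $\hat q_j=1$), and $p_i^{suc}=(p_i,\;p_i(1-p_j))$. The critical rate is $\lambda_i^{SR}(\lambda_j)=\sum_h\alpha(h)\,p_i^{suc}(h)$, computed for a saturated node $i$: $z_i=0$ and $z_j=\pi_j(1)/(1-\pi_j(0))$,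 where $\pi_j$ is the stationary queue length distribution of $MC_j$ restricted to $\hat q_i=1$; if there is none, node $j$ is saturated too and $z_j=0$. The stability region of the model is $SR=\{(\lambda_1,\lambda_2)\in(0,1)^2:\lambda_1<\lambda_1^{SR}(\lambda_2),\ \lambda_2<\lambda_2^{SR}(\lambda_1)\}$. (These are the case $n=2$, $K=0$ of the model of a network of $n$ nodes with $K$-exponential backoff with factor $r\ge1$.) **Theorem.** Let $p_1,p_2\in(0,1)$. 1. Let $\{i,j\}=\{1,2\}$. If $\lambda_j<p_j(1-p_i)$, then $z_j$, $\alpha$ and $\lambda_i^{SR}$ exist, are unique, and $$z_j=\frac{p_j(1-p_i)-\lambda_j}{(1-\lambda_j)p_j(1-p_i)},\qquad \alpha=\Bigl(1-\frac{\lambda_j}{p_j(1-p_i)},\ \frac{\lambda_j}{p_j(1-p_i)}\Bigr),\qquad \lambda_i^{SR}=p_i\Bigl(1-\frac{\lambda_j}{1-p_i}\Bigr).$$ If $\lambda_j\ge p_j(1-p_i)$, then $\lambda_i^{SR}$ exists, is unique, and $\lambda_i^{SR}=p_i(1-p_j)$. 2. $SR$ equals the exact stability region, and both are equal to the Rao–Ephremides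 region: the set of $(\lambda_1,\lambda_2)\in(0,1)^2$ such that $$\Bigl[\lambda_2<p_2(1-p_1)\text{ and }\lambda_1<p_1\Bigl(1-\frac{\lambda_2}{1-p_1}\Bigr)\Bigr]\ \text{ or }\ \Bigl[\lambda_1<p_1(1-p_2)\text{ and }\lambda_2<p_2\Bigl(1-\frac{\lambda_1}{1-p_2}\Bigr)\Bigr].$$ 3. $SR=\bigl\{(\lambda_1,\lambda_2)\in(0,1)^2:\lambda_1<p_1\bigl(1-\frac{\lambda_2}{1-p_1}\bigr),\ \lambda_2<p_2\bigl(1-\frac{\lambda_1}{1-p_2}\bigr)\bigr\}$ if and only if $p_1+p_2\le 1$. -/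

import Mathlib

namespace Aloha

/-- `π` is a stationary probability distribution of the transition function `P`
on a (countable) state space. -/
def IsStationary {S : Type*} (P : S → S → ℝ) (π : S → ℝ) : Prop :=
  (∀ s, 0 ≤ π s) ∧ HasSum π 1 ∧ ∀ t, HasSum (fun s => π s * P s t) (π t)

/-- The number of components of a 0-1 vector that are equal to 1. -/
def weight {n : ℕ} (a : Fin n → Bool) : ℕ :=
  (Finset.univ.filter fun k => a k = true).card

/-- The 0-1 vector whose only nonzero component is the `k`-th one. -/
def single {n : ℕ} (k : Fin n) : Fin n → Bool := fun l => decide (l = k)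

/-- Probability that the attempt vector is `a`, when the backoff stages are `b` and `busy k` says
whether the queue of node `k` is non-empty: every node with a packet transmits, independently,
with probability `p k / r ^ (b k)`. -/
noncomputable def attemptProb {n K : ℕ} (p : Fin n → ℝ) (r : ℝ) (b : Fin n → Fin (K + 1))
    (busy : Fin n → Bool) (a : Fin n → Bool) : ℝ :=
  ∏ k, (if a k = true then (if busy k = true then p k / r ^ (b k : ℕ) else 0)
    else 1 - (if busy k = true then p k / r ^ (b k : ℕ) else 0))

/-- The next backoff stages: unchanged for a silent node, reset to `0` on a success, and
incremented up to the cutoff stage `K` on a collision. -/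
def nextBackoff {n K : ℕ} (b : Fin n → Fin (K + 1)) (a : Fin n → Bool) : Fin n → Fin (K + 1) :=
  fun k =>
    if a k = false then b k
    else if ∀ j, j ≠ k → a j = false then 0
    else ⟨min ((b k : ℕ) + 1) K, by omega⟩

/-- Probability of `k` new packets in a slot for a Bernoulli arrival process of rate `l`. -/
noncomputable def arrivalProb (l : ℝ) (k : ℤ) : ℝ :=
  (1 - l) * (if k = 0 then 1 else 0) + l * (if k = 1 then 1 else 0)

/-! ### The exact network -/

/-- States `((q₁, b₁), …, (qₙ, bₙ))` of the network: queue lengths and backoff stages, the backoff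
stage of an empty queue being `0`. -/
def NetState (n K : ℕ) : Type :=
  {s : Fin n → ℕ × Fin (K + 1) // ∀ k, (s k).1 = 0 → (s k).2 = 0}

/-- Transition probabilities of the network itself. The departures are those of the unique
transmitter, if there is one, and are followed by the arrivals of the slot. -/
noncomputable def netTrans {n K : ℕ} (p : Fin n → ℝ) (r : ℝ) (lam : Fin n → ℝ)
    (s t : NetState n K) : ℝ :=
  ∑ a : Fin n → Bool,
    attemptProb p r (fun k => (s.1 k).2) (fun k => decide (0 < (s.1 k).1)) a *
    (if nextBackoff (fun k => (s.1 k).2) a = (fun k => (t.1 k).2) then 1 else 0) *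
    ∏ k, arrivalProb (lam k)
      (((t.1 k).1 : ℤ) - ((s.1 k).1 : ℤ) + (if a = single k then 1 else 0))

/-- The exact stability region: the rate vectors for which the Markov chain of the network has a
stationary distribution. -/
def exactRegion {n : ℕ} (K : ℕ) (p : Fin n → ℝ) (r : ℝ) : Set (Fin n → ℝ) :=
  {lam | (∀ k, 0 < lam k ∧ lam k < 1) ∧
    ∃ π : NetState n K → ℝ, IsStationary (netTrans p r lam) π}

/-! ### The approximate model: one quasi-birth-death chain per node -/

/-- Phases of the chain of node `i`: all backoff stages, and the indicators of non-emptiness of the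
other queues, the backoff stage of an empty queue being `0`. -/
abbrev Phase (n K : ℕ) (i : Fin n) : Type :=
  {h : (Fin n → Fin (K + 1)) × ({j : Fin n // j ≠ i} → Bool) //
    ∀ j : {j : Fin n // j ≠ i}, h.2 j = false → h.1 j.1 = 0}

/-- Non-emptiness of all the queues, when node `i` has `q` packets and the phase is `h`. -/
def busyVec {n K : ℕ} (i : Fin n) (q : ℕ) (h : Phase n K i) : Fin n → Bool :=
  fun k => if hk : k = i then decide (0 < q) else h.1.2 ⟨k, hk⟩

/-- Probability that the attempt vector `a` decrements the pair (queue length of node `i`,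
indicators of the other queues) by `d`. Here `z k` is the conditional probability that queue `k`
has exactly one packet, given that it is non-empty. -/
noncomputable def decrementProb {n : ℕ} (z : Fin n → ℝ) (i : Fin n) (a d : Fin n → Bool) : ℝ :=
  if weight a = 1 then
    ∑ k, if a k = true then
        (if k = i then (if d = single i then 1 else 0)
          else z k * (if d = single k then 1 else 0) +
            (1 - z k) * (if d = (fun _ => false) then 1 else 0))
      else 0
  else if d = (fun _ => false) then 1 else 0

/-- Probability that `k` new packets (the number being unrestricted by a change of the indicator
when the queue stays non-empty) change the non-emptiness indicator of a queue with arrival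
rate `l` from `u` to `u'`. -/
noncomputable def indicatorProb (l : ℝ) (u u' : Bool) (k : ℤ) : ℝ :=
  match u, u' with
  | _, false => (1 - l) * (if k = 0 then 1 else 0)
  | false, true => l * (if k = 1 then 1 else 0)
  | true, true => (if k = 0 then 1 else 0) + l * (if k = 1 then 1 else 0)

/-- Probability that the status of the queues changes from `(q, u)` to `(q', u')`, when the
attempt vector is `a`. -/
noncomputable def queueProb {n : ℕ} (lam z : Fin n → ℝ) (i : Fin n) (a : Fin n → Bool)
    (q : ℕ) (u : {j : Fin n // j ≠ i} → Bool) (q' : ℕ) (u' : {j : Fin n // j ≠ i} → Bool) : ℝ :=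
  ∑ d ∈ Finset.univ.filter (fun d : Fin n → Bool => weight d ≤ 1),
    decrementProb z i a d *
    arrivalProb (lam i) ((q' : ℤ) - (q : ℤ) + (d i).toInt) *
    ∏ j : {j : Fin n // j ≠ i},
      indicatorProb (lam j.1) (u j) (u' j) ((u' j).toInt - (u j).toInt + (d j.1).toInt)

/-- Transition probabilities of the chain of node `i` from level `q`, phase `h`, to level `q'`,
phase `h'`. -/
noncomputable def qbdTrans {n K : ℕ} (p : Fin n → ℝ) (r : ℝ) (lam z : Fin n → ℝ) (i : Fin n)
    (q : ℕ) (h : Phase n K i) (q' : ℕ) (h' : Phase n K i) : ℝ :=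
  ∑ a : Fin n → Bool,
    attemptProb p r h.1.1 (busyVec i q h) a *
    (if nextBackoff h.1.1 a = h'.1.1 then 1 else 0) *
    queueProb lam z i a q h.1.2 q' h'.1.2

/-- States of the chain of node `i`: level (the queue length of node `i`) and phase, the backoff
stage of node `i` being `0` in level `0`. -/
def QBDState (n K : ℕ) (i : Fin n) : Type :=
  {s : ℕ × Phase n K i // s.1 = 0 → s.2.1.1 i = 0}

/-- The mass that `π` gives to level `l`. -/
noncomputable def levelMass {n K : ℕ} {i : Fin n} (π : QBDState n K i → ℝ) (l : ℕ) : ℝ :=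
  ∑' s : QBDState n K i, if s.1.1 = l then π s else 0

/-- `π` is a stationary distribution of the chain of node `j` that is carried by the states in
which node `i` is non-empty (for a saturated node `i`, the others are transient). -/
def IsSaturatedStationary {n K : ℕ} (p : Fin n → ℝ) (r : ℝ) (lam z : Fin n → ℝ)
    (i j : Fin n) (hij : i ≠ j) (π : QBDState n K j → ℝ) : Prop :=
  IsStationary (fun s t : QBDState n K j => qbdTrans p r lam z j s.1.1 s.1.2 t.1.1 t.1.2) π ∧
    ∀ s : QBDState n K j, s.1.2.1.2 ⟨i, hij⟩ = false → π s = 0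

/-- `z` is the vector of the probabilities `z_j = π_j(1) / (1 - π_j(0))` when node `i` is saturated.
A saturated node has `z = 0`: this applies to node `i`, and to every other node whose chain has no
stationary distribution. -/
def IsSaturatedZ {n : ℕ} (K : ℕ) (p : Fin n → ℝ) (r : ℝ) (lam : Fin n → ℝ) (i : Fin n)
    (z : Fin n → ℝ) : Prop :=
  z i = 0 ∧ ∀ (j : Fin n) (hij : i ≠ j),
    (∃ π : QBDState n K j → ℝ, IsSaturatedStationary p r lam z i j hij π ∧
      z j = levelMass π 1 / (1 - levelMass π 0)) ∨
    ((¬ ∃ π : QBDState n K j → ℝ, IsSaturatedStationary p r lam z i j hij π) ∧ z j = 0)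

/-- The phase process matrix `A = A₀ + A₁ + A₂` of the chain of node `i`. The blocks are those out
of level `2`, hence out of any level `≥ 2`. -/
noncomputable def phaseMatrix {n K : ℕ} (p : Fin n → ℝ) (r : ℝ) (lam z : Fin n → ℝ) (i : Fin n)
    (h h' : Phase n K i) : ℝ :=
  qbdTrans p r lam z i 2 h 3 h' + qbdTrans p r lam z i 2 h 2 h' + qbdTrans p r lam z i 2 h 1 h'

/-- Probability of a successful transmission of node `i` in phase `h` of a level `≥ 2`. -/
noncomputable def successProb {n K : ℕ} (p : Fin n → ℝ) (r : ℝ) (i : Fin n)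
    (h : Phase n K i) : ℝ :=
  attemptProb p r h.1.1 (busyVec i 2 h) (single i)

/-- `v` is the critical rate `λ_i^SR = ∑ₕ α(h) p_i^suc(h)` of node `i`, computed for a saturated
node `i`, with `α` the stationary probability vector of `A`. -/
def IsCriticalRate {n : ℕ} (K : ℕ) (p : Fin n → ℝ) (r : ℝ) (lam : Fin n → ℝ) (i : Fin n)
    (v : ℝ) : Prop :=
  ∃ (z : Fin n → ℝ) (α : Phase n K i → ℝ), IsSaturatedZ K p r lam i z ∧
    IsStationary (phaseMatrix p r lam z i) α ∧ v = ∑ h, α h * successProb p r i h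

/-- The stability region of the model: each rate is below the critical rate. -/
def modelRegion {n : ℕ} (K : ℕ) (p : Fin n → ℝ) (r : ℝ) : Set (Fin n → ℝ) :=
  {lam | (∀ k, 0 < lam k ∧ lam k < 1) ∧ ∀ i, ∃ v, IsCriticalRate K p r lam i v ∧ lam i < v}

end Aloha

/-! Without backoff both the exact network and the model can be solved.

Model. When node `i` is saturated, the chain of node `j` restricted to "node `i` non-empty" is a
single-server queue with Bernoulli arrivals and success probability `s = p j * (1 - p i)`. Its
stationary law is geometric above level 0 and exists iff `lam j < s` (`IsStationary.queue`,
`exists_isStationary_queue`). The resulting `z j` makes the two-state phase process spend the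
fraction `lam j / s` of time in the non-empty phase, which is the true busy fraction of that queue.
This gives the critical rate. If `lam j ≥ s`, then `z j = 0` and the non-empty phase is absorbing. A
case split on which rates lie below their saturated service rates turns the two critical-rate
conditions into the Rao–Ephremides condition (`mem_modelRegion_iff`).

Exact network. The network is a random walk on `ℕ × ℕ` with bounded steps, and stability is decided
by drift arguments. Inside the region a quadratic Lyapunov function and Foster's criterion give a
stationary distribution (`exists_isStationary_slot`). Outside it, boundary included, a quadratic `F`
has drift at least a positive constant wherever it is large. A stationary mean of a bounded function
has zero drift, but `F` is unbounded. So `F` is composed with a bounded concave function whose slope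
`1 - η log x` decays so slowly that the second-order loss is of order `η` when the squared steps of
`F` are at most `g * F` with `g` of finite stationary mean. Letting `η → 0` shows that the states
with large `F` have mass zero (`IsStationary.eq_zero_of_drift`). But simultaneous arrivals put
positive mass along a diagonal, where `F` is unbounded: a contradiction.

Two such `F` are needed: one if some queue is stable against a saturated competitor
(`not_exists_isStationary_slot_of_lt`), one if neither is (`not_exists_isStationary_slot_of_le`).
Both must have a strictly positive constant drift even at the critical rates, where the linear part
of the drift vanishes. -/

namespace Aloha
open Filter Topology

/-! ### Chains with finitely many possible moves per state, and stationary means of drifts -/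

/-- Mean of `f` after one step of the chain that moves from `s` to `st s i` with probability
`w s i`. -/
noncomputable def avg {S I : Type*} [Fintype I] (w : S → I → ℝ) (st : S → I → S) (f : S → ℝ)
    (s : S) : ℝ := ∑ i, w s i * f (st s i)

open Classical in
/-- Transition probabilities of the chain that moves from `s` to `st s i` with probability
`w s i`. -/
noncomputable def kernel {S I : Type*} [Fintype I] (w : S → I → ℝ) (st : S → I → S) (s t : S) : ℝ :=
  ∑ i, w s i * if st s i = t then 1 else 0

section Chain

variable {S I : Type*} [Fintype I] {w : S → I → ℝ} {st : S → I → S}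

lemma avg_mono (h0 : ∀ s i, 0 ≤ w s i) {f g : S → ℝ} (h : ∀ s, f s ≤ g s) (s : S) :
    avg w st f s ≤ avg w st g s :=
  Finset.sum_le_sum fun i _ => mul_le_mul_of_nonneg_left (h _) (h0 s i)

lemma avg_const (h1 : ∀ s, ∑ i, w s i = 1) (a : ℝ) (s : S) : avg w st (fun _ => a) s = a := by
  simp [avg, ← Finset.sum_mul, h1]

lemma avg_nonneg (h0 : ∀ s i, 0 ≤ w s i) {f : S → ℝ} (h : ∀ s, 0 ≤ f s) (s : S) :
    0 ≤ avg w st f s := Finset.sum_nonneg fun i _ => mul_nonneg (h0 s i) (h _)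

lemma avg_add (f g : S → ℝ) (s : S) :
    avg w st (fun s => f s + g s) s = avg w st f s + avg w st g s := by
  simp [avg, mul_add, Finset.sum_add_distrib]

lemma avg_smul (a : ℝ) (f : S → ℝ) (s : S) :
    avg w st (fun s => a * f s) s = a * avg w st f s := by
  simp only [avg, Finset.mul_sum]
  exact Finset.sum_congr rfl fun i _ => by ring

lemma kernel_nonneg (h0 : ∀ s i, 0 ≤ w s i) (s t : S) : 0 ≤ kernel w st s t :=
  Finset.sum_nonneg fun i _ => mul_nonneg (h0 s i) (by split_ifs <;> norm_num)

lemma hasSum_kernel_mul (f : S → ℝ) (s : S) :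
    HasSum (fun t => kernel w st s t * f t) (avg w st f s) := by
  classical
  have h : (fun t => kernel w st s t * f t) =
      fun t => ∑ i, (if t = st s i then w s i * f (st s i) else 0) := by
    ext t
    rw [kernel, Finset.sum_mul]
    refine Finset.sum_congr rfl fun i _ => ?_
    by_cases h : st s i = t
    · simp [h]
    · simp [h, Ne.symm h]
  rw [h]
  exact hasSum_sum fun i _ => hasSum_ite_eq _ _

lemma hasSum_kernel (h1 : ∀ s, ∑ i, w s i = 1) (s : S) : HasSum (fun t => kernel w st s t) 1 := by
  have := hasSum_kernel_mul (w := w) (st := st) (fun _ => 1) s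
  rw [avg_const h1] at this
  simpa using this

/-- Mean preservation for bounded functions. -/
lemma IsStationary.tsum_avg {π : S → ℝ} (h0 : ∀ s i, 0 ≤ w s i) (h1 : ∀ s, ∑ i, w s i = 1)
    (hπ : IsStationary (kernel w st) π) {f : S → ℝ} {B : ℝ} (hf : ∀ s, |f s| ≤ B) :
    HasSum (fun s => π s * (avg w st f s - f s)) 0 := by
  obtain ⟨hp, hs, hst⟩ := hπ
  have hB (s : S) : ‖π s * f s‖ ≤ π s * B := by
    rw [norm_mul, Real.norm_of_nonneg (hp s)]
    exact mul_le_mul_of_nonneg_left (hf s) (hp s)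
  have hsum : Summable fun s => π s * f s :=
    Summable.of_norm_bounded (hs.summable.mul_right B) hB
  -- The joint law of two consecutive states: summing `f x.2` against it by rows gives the mean of
  -- `avg f`, by columns the mean of `f`.
  have hnn (x : S × S) : 0 ≤ π x.1 * kernel w st x.1 x.2 :=
    mul_nonneg (hp _) (kernel_nonneg h0 _ _)
  have hsumP : Summable fun x : S × S => π x.1 * kernel w st x.1 x.2 := by
    have hk (s : S) : HasSum (fun t => π s * kernel w st s t) (π s) := by
      simpa using (hasSum_kernel (st := st) h1 s).mul_left (π s)
    refine (summable_prod_of_nonneg hnn).2 ⟨fun s => (hk s).summable, ?_⟩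
    exact hs.summable.congr fun s => (hk s).tsum_eq.symm
  have hsumF : Summable fun x : S × S => π x.1 * kernel w st x.1 x.2 * f x.2 := by
    refine Summable.of_norm_bounded (hsumP.mul_right B) fun x => ?_
    rw [norm_mul, Real.norm_of_nonneg (hnn x)]
    exact mul_le_mul_of_nonneg_left (hf _) (hnn x)
  have e1 (s : S) : HasSum (fun t => π s * kernel w st s t * f t) (π s * avg w st f s) := by
    simpa [mul_assoc] using (hasSum_kernel_mul f s).mul_left (π s)
  have e2 : HasSum (fun s => π s * avg w st f s) (∑' s, π s * f s) := by
    have a1 := hsumF.hasSum.prod_fiberwise e1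
    have a2 := ((Equiv.prodComm S S).hasSum_iff.2 hsumF.hasSum).prod_fiberwise
      (g := fun t => π t * f t) fun t => (hst t).mul_right (f t)
    rwa [← a2.tsum_eq] at a1
  simpa [mul_sub] using e2.sub hsum.hasSum

/-- A drift bound for a nonnegative function bounds a stationary mean. -/
lemma IsStationary.summable_of_drift {π : S → ℝ} (h0 : ∀ s i, 0 ≤ w s i)
    (h1 : ∀ s, ∑ i, w s i = 1) (hπ : IsStationary (kernel w st) π) {V g : S → ℝ} {C : ℝ}
    (hV : ∀ s, 0 ≤ V s) (hg : ∀ s, 0 ≤ g s) (hC : 0 ≤ C)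
    (hd : ∀ s, avg w st V s ≤ V s - g s + C) : Summable fun s => π s * g s := by
  have hp := hπ.1
  refine summable_of_sum_le (c := C) (fun s => mul_nonneg (hp s) (hg s)) fun A => ?_
  obtain ⟨N, hN⟩ : ∃ N : ℝ, 0 ≤ N ∧ ∀ s ∈ A, V s + C ≤ N := by
    refine ⟨∑ s ∈ A, (V s + C), Finset.sum_nonneg fun s _ => add_nonneg (hV s) hC, fun s hs => ?_⟩
    exact Finset.single_le_sum (f := fun s => V s + C) (fun s _ => add_nonneg (hV s) hC) hs
  -- Truncation makes the function bounded without making its drift exceed `C`. Since `N ≥ V + C ≥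
  -- V` on `A`, there the drift bound for `V` is kept in full.
  set f : S → ℝ := fun s => min (V s) N with hf
  have hle (s : S) : avg w st f s ≤ min (V s - g s + C) N := by
    refine le_min ((avg_mono h0 (fun s => min_le_left _ _) s).trans (hd s)) ?_
    exact (avg_mono h0 (fun s => min_le_right _ _) s).trans (avg_const h1 N s).le
  have key := hπ.tsum_avg h0 h1 (f := f) (B := N) fun s => by
    rw [abs_of_nonneg (le_min (hV s) hN.1)]; exact min_le_right _ _
  have key2 := (hπ.2.1.mul_right C).sub key
  have hnn (s : S) : 0 ≤ π s * C - π s * (avg w st f s - f s) := by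
    rw [← mul_sub]
    refine mul_nonneg (hp s) ?_
    have := hle s
    have h3 : min (V s - g s + C) N ≤ f s + C := by
      rw [hf, ← min_add_add_right]
      exact min_le_min (by linarith [hg s]) (by linarith)
    linarith
  have := sum_le_hasSum A (fun s _ => hnn s) key2
  refine le_trans (Finset.sum_le_sum fun s hs => ?_) (this.trans_eq (by ring))
  rw [← mul_sub]
  refine mul_le_mul_of_nonneg_left ?_ (hp s)
  have h4 := (hle s).trans (min_le_left _ _)
  have h5 : f s = V s := min_eq_left (by linarith [hN.2 s hs])
  linarith

end Chain

/-! ### A bounded, slowly bending concave test function -/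

/-- A concave function on the positive reals whose slope `1 - η log x` varies slowly. -/
noncomputable def slowlyBent (η x : ℝ) : ℝ := x + η * (x - x * Real.log x)

/-- The second derivative is `-η / x`, so the loss against the tangent at `a` is of order `η (b -
a)² / a`. The exact form follows from `log (b / a) ≤ b / a - 1`, with no restriction on the size of
the step. -/
lemma slowlyBent_lower {η a b : ℝ} (hη : 0 ≤ η) (ha : 0 < a) (hb : 0 < b) :
    slowlyBent η a + (1 - η * Real.log a) * (b - a) - η * ((b - a) ^ 2 / a) ≤ slowlyBent η b := by
  have h := Real.log_le_sub_one_of_pos (div_pos hb ha)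
  rw [Real.log_div hb.ne' ha.ne'] at h
  have h2 : b * (Real.log b - Real.log a) ≤ b * (b / a - 1) := mul_le_mul_of_nonneg_left h hb.le
  have h3 : (b - a) ^ 2 / a = b * (b / a - 1) - (b - a) := by field_simp
  unfold slowlyBent
  rw [h3]
  nlinarith [mul_le_mul_of_nonneg_left h2 hη]

lemma slowlyBent_upper {η a b : ℝ} (hη : 0 ≤ η) (ha : 0 < a) (hb : 0 < b) :
    slowlyBent η b ≤ slowlyBent η a + (1 - η * Real.log a) * (b - a) := by
  have h := Real.log_le_sub_one_of_pos (div_pos ha hb)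
  rw [Real.log_div ha.ne' hb.ne'] at h
  have h2 : b * (Real.log a - Real.log b) ≤ b * (a / b - 1) := mul_le_mul_of_nonneg_left h hb.le
  have h3 : b * (a / b - 1) = a - b := by field_simp
  unfold slowlyBent
  nlinarith [mul_le_mul_of_nonneg_left h2 hη]

/-- The function `slowlyBent`, made constant below `M` and above its maximum point. -/
noncomputable def bentClamp (η M x : ℝ) : ℝ :=
  slowlyBent η (max M (min x (Real.exp (1 / η))))

/-- The tangent estimate survives the clamping: raising `b` to `M` shortens the step, since `a > M`,
and cutting off at the maximum point only increases the value. Beyond the maximum point the slope is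
replaced by 0. -/
lemma bentClamp_lower {η M a b : ℝ} (hη : 0 < η) (hM : 0 < M) (hME : M ≤ Real.exp (1 / η))
    (ha : M < a) :
    bentClamp η M a + max 0 (1 - η * Real.log a) * (b - a) - η * ((b - a) ^ 2 / a) ≤
      bentClamp η M b := by
  set E := Real.exp (1 / η) with hE
  have hE0 : 0 < E := Real.exp_pos _
  have hlogE : 1 - η * Real.log E = 0 := by rw [hE, Real.log_exp]; field_simp; simp
  have ha0 : 0 < a := hM.trans ha
  have hb0 : 0 < max M b := lt_max_of_lt_left hM
  have hsq : (max M b - a) ^ 2 ≤ (b - a) ^ 2 := by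
    rcases le_total M b with h | h
    · rw [max_eq_right h]
    · rw [max_eq_left h]; nlinarith
  have hbE : b ≤ E → max M (min b E) = max M b := fun h => by rw [min_eq_left h]
  have hmaxE : max M E = E := max_eq_right hME
  unfold bentClamp
  rw [← hE]
  rcases le_or_gt a E with haE | haE
  · rw [min_eq_left haE, max_eq_right ha.le]
    have hD : 0 ≤ 1 - η * Real.log a := by
      have := Real.log_le_log ha0 haE
      nlinarith
    rw [max_eq_right hD]
    have h1 : slowlyBent η (max M b) ≤ slowlyBent η (max M (min b E)) := by
      rcases le_or_gt b E with h | h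
      · rw [hbE h]
      · rw [min_eq_right h.le, hmaxE]
        refine (slowlyBent_upper hη.le hE0 hb0).trans_eq ?_
        rw [hlogE]; ring
    refine le_trans ?_ ((slowlyBent_lower hη.le ha0 hb0).trans h1)
    have h2 : (max M b - a) ^ 2 / a ≤ (b - a) ^ 2 / a := by gcongr
    have h3 := mul_le_mul_of_nonneg_left h2 hη.le
    have h4 : (1 - η * Real.log a) * (b - a) ≤ (1 - η * Real.log a) * (max M b - a) :=
      mul_le_mul_of_nonneg_left (by linarith [le_max_right M b]) hD
    linarith
  · have hD : 1 - η * Real.log a ≤ 0 := by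
      have := Real.log_le_log hE0 haE.le
      nlinarith
    rw [min_eq_right haE.le, hmaxE, max_eq_left hD]
    rcases le_or_gt b E with h | h
    · rw [hbE h]
      have h1 := slowlyBent_lower hη.le hE0 hb0
      rw [hlogE] at h1
      have hmE : max M b ≤ E := max_le hME h
      -- The value at `a` is that of the maximum point `E < a`, so the tangent is taken at `E`; for
      -- `b' = max M b ≤ E` the quotient `(b' - x)² / x` increases from `x = E` to `x = a`.
      have h2 : (max M b - E) ^ 2 / E ≤ (max M b - a) ^ 2 / a := by
        rw [div_le_div_iff₀ hE0 ha0]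
        have : 0 ≤ (a - E) * (a * E - max M b ^ 2) :=
          mul_nonneg (by linarith) (by nlinarith)
        nlinarith
      have h3 : (max M b - a) ^ 2 / a ≤ (b - a) ^ 2 / a := by gcongr
      have h4 := mul_le_mul_of_nonneg_left (h2.trans h3) hη.le
      linarith
    · rw [min_eq_right h.le, hmaxE]
      have : 0 ≤ η * ((b - a) ^ 2 / a) := by positivity
      linarith

lemma slowlyBent_le_exp {η x : ℝ} (hη : 0 < η) (hx : 0 < x) :
    slowlyBent η x ≤ slowlyBent η (Real.exp (1 / η)) := by
  refine (slowlyBent_upper hη.le (Real.exp_pos (1 / η)) hx).trans_eq ?_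
  rw [Real.log_exp, mul_one_div_cancel hη.ne']; ring

lemma bentClamp_ge {η M x : ℝ} (hη : 0 < η) (hM : 0 < M) (hME : M ≤ Real.exp (1 / η)) :
    slowlyBent η M ≤ bentClamp η M x := by
  unfold bentClamp
  set y := max M (min x (Real.exp (1 / η)))
  have hy : M ≤ y := le_max_left _ _
  have hyE : y ≤ Real.exp (1 / η) := max_le hME (min_le_right _ _)
  have hy0 : 0 < y := hM.trans_le hy
  have h := slowlyBent_upper hη.le hy0 hM
  have hD : 0 ≤ 1 - η * Real.log y := by
    have h2 := Real.log_le_log hy0 hyE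
    rw [Real.log_exp] at h2
    have h3 := mul_le_mul_of_nonneg_left h2 hη.le
    rw [mul_one_div_cancel hη.ne'] at h3
    linarith
  nlinarith

/-! ### Drift criteria for absence and existence of a stationary distribution -/

section Chain

variable {S I : Type*} [Fintype I] {w : S → I → ℝ} {st : S → I → S}

/-- If `F` drifts upwards where it is large, and its steps are of order `√F` there, then a
stationary distribution gives no mass to the states where `F` is large. -/
lemma IsStationary.eq_zero_of_drift {π : S → ℝ} (h0 : ∀ s i, 0 ≤ w s i)
    (h1 : ∀ s, ∑ i, w s i = 1) (hπ : IsStationary (kernel w st) π) {F g : S → ℝ} {M c : ℝ}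
    (hM : 0 < M) (hc : 0 < c) (hg0 : ∀ s, 0 ≤ g s) (hg : Summable fun s => π s * g s)
    (hd : ∀ s, M < F s → F s + c ≤ avg w st F s)
    (hstep : ∀ s, M < F s → ∀ i, (F (st s i) - F s) ^ 2 ≤ g s * F s) {s₀ : S} (hs₀ : M < F s₀) :
    π s₀ = 0 := by
  have hp := hπ.1
  -- The bent function of `F` is bounded, so its stationary mean drift is 0. The gain at `s₀` alone
  -- therefore cannot exceed the total second-order loss `η ∑ π g`.
  have key (η : ℝ) (hη : 0 < η) (hME : M ≤ Real.exp (1 / η)) :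
      π s₀ * ((1 - η * Real.log (F s₀)) * c) ≤ η * ∑' s, π s * g s := by
    have hdr (s : S) : (if M < F s then max 0 (1 - η * Real.log (F s)) * c else 0) - η * g s ≤
        avg w st (fun s => bentClamp η M (F s)) s - bentClamp η M (F s) := by
      split_ifs with h
      · have hF : 0 < F s := hM.trans h
        set D := max 0 (1 - η * Real.log (F s)) with hD
        have hD0 : 0 ≤ D := le_max_left _ _
        have e1 : avg w st (fun t => bentClamp η M (F s) + D * (F t - F s) - η * g s) s ≤
            avg w st (fun s => bentClamp η M (F s)) s := by
          refine Finset.sum_le_sum fun i _ => mul_le_mul_of_nonneg_left ?_ (h0 s i)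
          refine le_trans ?_ (bentClamp_lower hη hM hME h)
          have : (F (st s i) - F s) ^ 2 / F s ≤ g s := by
            rw [div_le_iff₀ hF]; exact hstep s h i
          have := mul_le_mul_of_nonneg_left this hη.le
          linarith
        have e2 : avg w st (fun t => bentClamp η M (F s) + D * (F t - F s) - η * g s) s =
            bentClamp η M (F s) - D * F s - η * g s + D * avg w st F s := by
          rw [← avg_smul, ← avg_const (w := w) (st := st) h1
            (bentClamp η M (F s) - D * F s - η * g s) s, ← avg_add]
          congr 1; ext t; ring
        nlinarith [mul_le_mul_of_nonneg_left (hd s h) hD0]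
      · have e1 : bentClamp η M (F s) = slowlyBent η M := by
          unfold bentClamp
          rw [max_eq_left ((min_le_left _ _).trans (not_lt.1 h))]
        have e2 : slowlyBent η M ≤ avg w st (fun s => bentClamp η M (F s)) s := by
          rw [← avg_const (w := w) (st := st) h1 (slowlyBent η M) s]
          exact avg_mono h0 (fun s => bentClamp_ge hη hM hME) s
        have := mul_nonneg hη.le (hg0 s)
        linarith
    have hb (s : S) : |bentClamp η M (F s)| ≤
        |slowlyBent η M| + |slowlyBent η (Real.exp (1 / η))| := by
      have l1 := bentClamp_ge (x := F s) hη hM hME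
      have l2 : bentClamp η M (F s) ≤ slowlyBent η (Real.exp (1 / η)) :=
        slowlyBent_le_exp hη (lt_max_of_lt_left hM)
      rw [abs_le]
      constructor
      · linarith [neg_abs_le (slowlyBent η M), abs_nonneg (slowlyBent η (Real.exp (1 / η)))]
      · linarith [le_abs_self (slowlyBent η (Real.exp (1 / η))), abs_nonneg (slowlyBent η M)]
    have k1 := (hπ.tsum_avg h0 h1 hb).add (hg.hasSum.mul_left η)
    rw [zero_add] at k1
    have k2 (s : S) : π s * (if M < F s then max 0 (1 - η * Real.log (F s)) * c else 0) ≤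
        π s * (avg w st (fun s => bentClamp η M (F s)) s - bentClamp η M (F s)) +
          η * (π s * g s) := by
      nlinarith [mul_le_mul_of_nonneg_left (hdr s) (hp s)]
    have k3 (s : S) : 0 ≤ π s * (if M < F s then max 0 (1 - η * Real.log (F s)) * c else 0) := by
      refine mul_nonneg (hp s) ?_
      split_ifs
      · positivity
      · exact le_rfl
    have k4 := le_hasSum k1 s₀ fun s _ => (k3 s).trans (k2 s)
    refine le_trans ?_ ((k2 s₀).trans k4)
    rw [if_pos hs₀]
    gcongr
    · exact hp s₀
    · exact le_max_right _ _
  have l1 : Tendsto (fun η : ℝ => π s₀ * ((1 - η * Real.log (F s₀)) * c)) (𝓝[>] 0)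
      (𝓝 (π s₀ * ((1 - 0 * Real.log (F s₀)) * c))) :=
    ((Continuous.tendsto (by fun_prop) 0).mono_left nhdsWithin_le_nhds)
  have l2 : Tendsto (fun η : ℝ => η * ∑' s, π s * g s) (𝓝[>] 0) (𝓝 (0 * ∑' s, π s * g s)) :=
    ((Continuous.tendsto (by fun_prop) 0).mono_left nhdsWithin_le_nhds)
  have l3 : ∀ᶠ η : ℝ in 𝓝[>] 0, M ≤ Real.exp (1 / η) := by
    have : Tendsto (fun η : ℝ => Real.exp (1 / η)) (𝓝[>] 0) atTop := by
      simp only [one_div]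
      exact Real.tendsto_exp_atTop.comp tendsto_inv_nhdsGT_zero
    exact this.eventually_ge_atTop M
  have l4 := le_of_tendsto_of_tendsto l1 l2 (by
    filter_upwards [l3, self_mem_nhdsWithin] with η h h' using key η h' h)
  have := hp s₀
  simp only [zero_mul, sub_zero, one_mul] at l4
  nlinarith

/-- Foster's criterion. -/
lemma exists_isStationary_of_drift [DecidableEq S] (h0 : ∀ s i, 0 ≤ w s i) (h1 : ∀ s, ∑ i, w s i = 1)
    {V : S → ℝ} (hV : ∀ s, 0 ≤ V s) (C : Finset S) (s₀ : S) {b : ℝ}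
    (hd : ∀ s, avg w st V s ≤ V s - 1 + b * ∑ u ∈ C, if s = u then 1 else 0) :
    ∃ π, IsStationary (kernel w st) π := by
  have hs (f : S → ℝ) : (∀ s, 0 ≤ f s) → ∀ n, 0 ≤ (avg w st)^[n] f s₀ := by
    intro hf n
    have : ∀ s, 0 ≤ (avg w st)^[n] f s := by
      induction n with
      | zero => exact hf
      | succ n ih => rw [Function.iterate_succ_apply']; exact avg_nonneg h0 ih
    exact this s₀
  -- `L n f` is the expectation of `f` after `n` steps from `s₀`.
  have lin : ∀ n, ∃ L : (S → ℝ) →ₗ[ℝ] ℝ, ∀ f, L f = (avg w st)^[n] f s₀ := by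
    let A : (S → ℝ) →ₗ[ℝ] (S → ℝ) :=
      { toFun := avg w st
        map_add' := fun f g => funext fun s => avg_add f g s
        map_smul' := fun a f => funext fun s => avg_smul a f s }
    intro n
    refine ⟨(LinearMap.proj s₀).comp (A ^ n), fun f => ?_⟩
    simp only [LinearMap.comp_apply, LinearMap.proj_apply, Module.End.pow_apply]
    rfl
  choose L hL using lin
  have hL0 (n : ℕ) {f : S → ℝ} (hf : ∀ s, 0 ≤ f s) : 0 ≤ L n f := by rw [hL]; exact hs f hf n
  have hLm (n : ℕ) {f g : S → ℝ} (h : ∀ s, f s ≤ g s) : L n f ≤ L n g := by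
    have := hL0 n (f := g - f) fun s => sub_nonneg.2 (h s)
    rw [map_sub] at this; linarith
  have hLavg (n : ℕ) (f : S → ℝ) : L n (avg w st f) = L (n + 1) f := by
    rw [hL, hL, Function.iterate_succ_apply]
  have hL1 (n : ℕ) : L n (fun _ => 1) = 1 := by
    induction n with
    | zero => simp [hL]
    | succ n ih =>
      have : avg w st (fun _ => (1 : ℝ)) = fun _ => 1 := funext fun s => avg_const h1 1 s
      rw [← hLavg, this, ih]
  let ind : S → S → ℝ := fun u s => if s = u then 1 else 0
  have hind (u s : S) : 0 ≤ ind u s := by simp only [ind]; split_ifs <;> norm_num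
  have hind1 (u s : S) : ind u s ≤ 1 := by simp only [ind]; split_ifs <;> norm_num
  -- Mean occupation frequencies up to time `N`. A limit along an ultrafilter exists at all states
  -- at once, which replaces a diagonal extraction.
  let a : ℕ → S → ℝ := fun N u => (∑ n ∈ Finset.range N, L n (ind u)) / N
  have ha0 (N : ℕ) (u : S) : 0 ≤ a N u :=
    div_nonneg (Finset.sum_nonneg fun n _ => hL0 n (hind u)) (Nat.cast_nonneg N)
  have hsub (N : ℕ) (A : Finset S) : ∑ u ∈ A, a N u ≤ 1 := by
    simp only [a]
    rw [← Finset.sum_div, Finset.sum_comm]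
    refine div_le_one_of_le₀ ?_ (Nat.cast_nonneg N)
    calc _ ≤ ∑ n ∈ Finset.range N, (1 : ℝ) := Finset.sum_le_sum fun n _ => by
          rw [← map_sum, ← hL1 n]
          refine hLm n fun s => ?_
          rw [Finset.sum_apply]
          simp only [ind, Finset.sum_ite_eq]
          split_ifs <;> norm_num
      _ = N := by simp
  let U : Ultrafilter ℕ := hyperfilter ℕ
  have hU : (U : Filter ℕ) ≤ atTop := by
    rw [← Nat.cofinite_eq_atTop]; exact hyperfilter_le_cofinite
  have hlim (u : S) : ∃ l, Tendsto (fun N : ℕ => a N u) U (𝓝 l) := by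
    have hK : IsCompact (Set.Icc (0 : ℝ) 1) := isCompact_Icc
    obtain ⟨l, -, hl⟩ := hK.ultrafilter_le_nhds (U.map fun N => a N u) (by
      rw [le_principal_iff, Ultrafilter.coe_map]
      exact Filter.mem_map.2 (Filter.univ_mem' fun N : ℕ => ⟨ha0 N u, by simpa using hsub N {u}⟩))
    exact ⟨l, hl⟩
  choose π hπ using hlim
  have hp (u : S) : 0 ≤ π u := ge_of_tendsto' (hπ u) fun N => ha0 N u
  have hp1 (A : Finset S) : ∑ u ∈ A, π u ≤ 1 :=
    le_of_tendsto' (tendsto_finsetSum A fun u _ => hπ u) fun N => hsub N A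
  have hsum : Summable π := summable_of_sum_le hp hp1
  -- The time averages are invariant up to an error `1 / N`. As mass may escape to infinity, the
  -- limit is at first only subinvariant.
  have hsubinv (A : Finset S) (t : S) : ∑ u ∈ A, π u * kernel w st u t ≤ π t := by
    have e1 : Tendsto (fun N => ∑ u ∈ A, a N u * kernel w st u t) U
        (𝓝 (∑ u ∈ A, π u * kernel w st u t)) :=
      tendsto_finsetSum A fun u _ => (hπ u).mul_const _
    have e2 : Tendsto (fun N : ℕ => a N t + 1 / (N : ℝ)) U (𝓝 (π t + 0)) :=
      (hπ t).add (tendsto_one_div_atTop_nhds_zero_nat.mono_left hU)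
    rw [add_zero] at e2
    refine le_of_tendsto_of_tendsto' e1 e2 fun N => ?_
    simp only [a]
    rw [← add_div]
    simp only [div_mul_eq_mul_div, ← Finset.sum_div, Finset.sum_mul]
    refine div_le_div_of_nonneg_right ?_ (Nat.cast_nonneg N)
    rw [Finset.sum_comm]
    have e3 (n : ℕ) : ∑ u ∈ A, L n (ind u) * kernel w st u t ≤ L (n + 1) (ind t) := by
      rw [← hLavg]
      have : ∑ u ∈ A, L n (ind u) * kernel w st u t =
          L n (∑ u ∈ A, kernel w st u t • ind u) := by
        rw [map_sum]
        exact Finset.sum_congr rfl fun u _ => by rw [map_smul, smul_eq_mul, mul_comm]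
      rw [this]
      refine hLm n fun s => ?_
      have hk : avg w st (ind t) s = kernel w st s t := by
        simp only [avg, kernel, ind]
        exact Finset.sum_congr rfl fun i _ => by congr
      rw [Finset.sum_apply, hk]
      simp only [Pi.smul_apply, smul_eq_mul, ind, mul_ite, mul_one, mul_zero, Finset.sum_ite_eq]
      split_ifs
      · exact le_rfl
      · exact kernel_nonneg h0 _ _
    calc _ ≤ ∑ n ∈ Finset.range N, L (n + 1) (ind t) := Finset.sum_le_sum fun n _ => e3 n
      _ ≤ (∑ n ∈ Finset.range N, L (n + 1) (ind t)) + L 0 (ind t) := by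
          linarith [hL0 0 (hind t)]
      _ = (∑ n ∈ Finset.range N, L n (ind t)) + L N (ind t) := by
          rw [← Finset.sum_range_succ' fun n => L n (ind t), Finset.sum_range_succ]
      _ ≤ _ := by
          have := hLm N (hind1 t)
          rw [hL1] at this
          linarith
  -- Telescoping the drift inequality bounds from below the frequency of visits to the finite set
  -- `C`, so not all mass escapes.
  have hpos : 1 ≤ b * ∑ u ∈ C, π u := by
    have e1 : Tendsto (fun N : ℕ => b * ∑ u ∈ C, a N u + V s₀ / (N : ℝ)) U
        (𝓝 (b * ∑ u ∈ C, π u + 0)) :=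
      ((tendsto_finsetSum C fun u _ => hπ u).const_mul b).add
        ((tendsto_const_div_atTop_nhds_zero_nat (V s₀)).mono_left hU)
    rw [add_zero] at e1
    have e2 (n : ℕ) : L (n + 1) V ≤ L n V - 1 + b * ∑ u ∈ C, L n (ind u) := by
      rw [← hLavg]
      have : L n V - 1 + b * ∑ u ∈ C, L n (ind u) =
          L n (V - (fun _ => 1) + b • ∑ u ∈ C, ind u) := by
        rw [map_add, map_sub, map_smul, map_sum, hL1, smul_eq_mul]
      rw [this]
      refine hLm n fun s => ?_
      simpa [ind] using hd s
    have e3 (N : ℕ) : (N : ℝ) ≤ V s₀ - L N V + b * ∑ u ∈ C, ∑ n ∈ Finset.range N, L n (ind u) := by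
      induction N with
      | zero => simp [hL]
      | succ N ih =>
        simp only [Finset.sum_range_succ, Finset.sum_add_distrib, mul_add]
        push_cast
        linarith [e2 N]
    refine ge_of_tendsto e1 ?_
    filter_upwards [hU (eventually_gt_atTop 0)] with N hN
    have hN' : (0 : ℝ) < N := by exact_mod_cast hN
    simp only [a]
    rw [← Finset.sum_div, ← mul_div_assoc, ← add_div, le_div_iff₀ hN', one_mul]
    linarith [e3 N, hL0 N hV]
  have hm : 0 < ∑' u, π u := by
    by_contra h
    have h3 : ∑' u, π u = 0 := le_antisymm (not_lt.1 h) (tsum_nonneg hp)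
    have h4 : π = 0 := (hsum.hasSum_iff.2 h3 |> fun h => (hasSum_zero_iff_of_nonneg hp).1 h)
    simp [h4] at hpos
    linarith
  -- The image measure is pointwise at most `π` and has the same finite total mass, hence they
  -- agree.
  have hinv (t : S) : HasSum (fun s => π s * kernel w st s t) (π t) := by
    have hnn (x : S × S) : 0 ≤ π x.1 * kernel w st x.1 x.2 :=
      mul_nonneg (hp _) (kernel_nonneg h0 _ _)
    have hk (s : S) : HasSum (fun t => π s * kernel w st s t) (π s) := by
      simpa using (hasSum_kernel (st := st) h1 s).mul_left (π s)
    have hsumP : Summable fun x : S × S => π x.1 * kernel w st x.1 x.2 :=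
      (summable_prod_of_nonneg hnn).2
        ⟨fun s => (hk s).summable, hsum.congr fun s => (hk s).tsum_eq.symm⟩
    have hcol (t : S) : Summable fun s => π s * kernel w st s t :=
      summable_of_sum_le (fun s => hnn (s, t)) fun A => hsubinv A t
    have htot := ((Equiv.prodComm S S).hasSum_iff.2 hsumP.hasSum).prod_fiberwise
      (g := fun t => ∑' s, π s * kernel w st s t) fun t => (hcol t).hasSum
    rw [← (hsumP.hasSum.prod_fiberwise hk).tsum_eq] at htot
    have hle (t : S) : ∑' s, π s * kernel w st s t ≤ π t :=
      (hcol t).tsum_le_of_sum_le fun A => hsubinv A t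
    have hz := hsum.hasSum.sub htot
    rw [sub_self, hasSum_zero_iff_of_nonneg fun t => sub_nonneg.2 (hle t)] at hz
    have := congrFun hz t
    have h5 : ∑' s, π s * kernel w st s t = π t := by
      simp only [Pi.zero_apply] at this; linarith
    rw [← h5]
    exact (hcol t).hasSum
  refine ⟨fun s => π s / ∑' u, π u, fun s => div_nonneg (hp s) hm.le, ?_, fun t => ?_⟩
  · simpa [div_self hm.ne'] using hsum.hasSum.div_const (∑' u, π u)
  · simpa [div_mul_eq_mul_div] using (hinv t).div_const (∑' u, π u)

end Chain

/-! ### The two-node chain without backoff -/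

/-- Probability that a node with queue length `x` and attempt probability `p` succeeds, when the
other node has queue length `y` and attempt probability `q`. -/
noncomputable def success (p q : ℝ) (x y : ℕ) : ℝ :=
  if x = 0 then 0 else p * (if y = 0 then 1 else 1 - q)

/-- Probability of an event of a slot: the departure (`0`: none, `1`: node 0, `2`: node 1) and the
two arrivals. -/
noncomputable def slotProb (p q l m : ℝ) (s : ℕ × ℕ) (i : Fin 3 × Bool × Bool) : ℝ :=
  ![1 - success p q s.1 s.2 - success q p s.2 s.1, success p q s.1 s.2, success q p s.2 s.1] i.1 *
    ((if i.2.1 then l else 1 - l) * (if i.2.2 then m else 1 - m))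

/-- The queue lengths after a slot. -/
def slotStep (s : ℕ × ℕ) (i : Fin 3 × Bool × Bool) : ℕ × ℕ :=
  (s.1 - (if i.1 = 1 then 1 else 0) + (if i.2.1 then 1 else 0),
    s.2 - (if i.1 = 2 then 1 else 0) + (if i.2.2 then 1 else 0))

/-- Mean over the arrivals of a slot. -/
noncomputable def arrivalMean (l m : ℝ) (f : ℕ × ℕ → ℝ) (x y : ℕ) : ℝ :=
  (1 - l) * (1 - m) * f (x, y) + l * (1 - m) * f (x + 1, y) + (1 - l) * m * f (x, y + 1) +
    l * m * f (x + 1, y + 1)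

section

variable {p q l m : ℝ}

lemma slotProb_nonneg (hp : 0 < p ∧ p < 1) (hq : 0 < q ∧ q < 1) (hl : 0 < l ∧ l < 1)
    (hm : 0 < m ∧ m < 1) (s : ℕ × ℕ) (i : Fin 3 × Bool × Bool) : 0 ≤ slotProb p q l m s i := by
  have h1 : 0 ≤ (if i.2.1 then l else 1 - l) := by split_ifs <;> linarith
  have h2 : 0 ≤ (if i.2.2 then m else 1 - m) := by split_ifs <;> linarith
  refine mul_nonneg ?_ (mul_nonneg h1 h2)
  have h3 : 0 ≤ p * (1 - q) := mul_nonneg hp.1.le (by linarith)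
  have h4 : 0 ≤ q * (1 - p) := mul_nonneg hq.1.le (by linarith)
  have h5 : 0 ≤ (1 - p) * (1 - q) := mul_nonneg (by linarith) (by linarith)
  have h6 : 0 ≤ p * q := mul_nonneg hp.1.le hq.1.le
  obtain ⟨d, -, -⟩ := i
  fin_cases d <;> simp [success] <;> split_ifs <;> nlinarith

lemma sum_slotProb (s : ℕ × ℕ) : ∑ i, slotProb p q l m s i = 1 := by
  simp only [slotProb, Fintype.sum_prod_type, Fin.sum_univ_three, Fintype.sum_bool]
  simp
  ring

lemma avg_slot_zero_zero (f : ℕ × ℕ → ℝ) :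
    avg (slotProb p q l m) slotStep f (0, 0) = arrivalMean l m f 0 0 := by
  simp only [avg, slotProb, slotStep, arrivalMean, Fintype.sum_prod_type, Fin.sum_univ_three,
    Fintype.sum_bool]
  simp [success]
  ring

lemma avg_slot_succ_zero (f : ℕ × ℕ → ℝ) (x : ℕ) :
    avg (slotProb p q l m) slotStep f (x + 1, 0) =
      p * arrivalMean l m f x 0 + (1 - p) * arrivalMean l m f (x + 1) 0 := by
  simp only [avg, slotProb, slotStep, arrivalMean, Fintype.sum_prod_type, Fin.sum_univ_three,
    Fintype.sum_bool]
  simp [success]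
  ring

lemma avg_slot_zero_succ (f : ℕ × ℕ → ℝ) (y : ℕ) :
    avg (slotProb p q l m) slotStep f (0, y + 1) =
      q * arrivalMean l m f 0 y + (1 - q) * arrivalMean l m f 0 (y + 1) := by
  simp only [avg, slotProb, slotStep, arrivalMean, Fintype.sum_prod_type, Fin.sum_univ_three,
    Fintype.sum_bool]
  simp [success]
  ring

lemma avg_slot_succ_succ (f : ℕ × ℕ → ℝ) (x y : ℕ) :
    avg (slotProb p q l m) slotStep f (x + 1, y + 1) =
      p * (1 - q) * arrivalMean l m f x (y + 1) + q * (1 - p) * arrivalMean l m f (x + 1) y +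
        (1 - p * (1 - q) - q * (1 - p)) * arrivalMean l m f (x + 1) (y + 1) := by
  simp only [avg, slotProb, slotStep, arrivalMean, Fintype.sum_prod_type, Fin.sum_univ_three,
    Fintype.sum_bool]
  simp [success]
  ring

lemma slotStep_near (s : ℕ × ℕ) (i : Fin 3 × Bool × Bool) :
    |((slotStep s i).1 : ℝ) - s.1| ≤ 1 ∧ |((slotStep s i).2 : ℝ) - s.2| ≤ 1 := by
  obtain ⟨x, y⟩ := s
  obtain ⟨d, e, f⟩ := i
  have h (z : ℕ) (u v : Prop) [Decidable u] [Decidable v] :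
      |((z - (if u then 1 else 0) + (if v then 1 else 0) : ℕ) : ℝ) - z| ≤ 1 := by
    -- Departures from an empty queue are among the formal events, with probability 0; truncated
    -- subtraction keeps these steps bounded too.
    rcases z with _ | z <;> split_ifs <;> simp
  exact ⟨h x _ _, h y _ _⟩

/-- A sequence of simultaneous arrivals without departures has positive probability. -/
lemma IsStationary.exists_pos_diag (hp : 0 < p ∧ p < 1) (hq : 0 < q ∧ q < 1) (hl : 0 < l ∧ l < 1)
    (hm : 0 < m ∧ m < 1) {π : ℕ × ℕ → ℝ}
    (hπ : IsStationary (kernel (slotProb p q l m) slotStep) π) :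
    ∃ x y : ℕ, ∀ n : ℕ, 0 < π (x + n, y + n) := by
  have h0 := slotProb_nonneg hp hq hl hm
  have : ∃ s, 0 < π s := by
    by_contra! h
    have h2 : π = 0 := funext fun s => le_antisymm (h s) (hπ.1 s)
    have := hπ.2.1
    rw [h2] at this
    exact zero_ne_one (hasSum_zero.unique this)
  obtain ⟨⟨x, y⟩, hs⟩ := this
  refine ⟨x, y, fun n => ?_⟩
  induction n with
  | zero => exact hs
  | succ n ih =>
    have h1 := le_hasSum (hπ.2.2 (x + (n + 1), y + (n + 1))) (x + n, y + n)
      fun s _ => mul_nonneg (hπ.1 s) (kernel_nonneg h0 _ _)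
    refine lt_of_lt_of_le (mul_pos ih ?_) h1
    have h2 : slotProb p q l m (x + n, y + n) (0, true, true) ≤
        kernel (slotProb p q l m) slotStep (x + n, y + n) (x + (n + 1), y + (n + 1)) := by
      have h3 := Finset.single_le_sum (s := Finset.univ)
        (f := fun i => slotProb p q l m (x + n, y + n) i *
          if slotStep (x + n, y + n) i = (x + (n + 1), y + (n + 1)) then 1 else 0)
        (fun i _ => mul_nonneg (h0 _ i) (by split_ifs <;> norm_num))
        (Finset.mem_univ (0, true, true))
      have h4 : slotStep (x + n, y + n) (0, true, true) = (x + (n + 1), y + (n + 1)) := by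
        simp [slotStep, add_assoc]
      simp only [h4, if_true, mul_one] at h3
      refine h3.trans_eq ?_
      unfold kernel
      exact Finset.sum_congr rfl fun i _ => by congr
    refine lt_of_lt_of_le ?_ h2
    have h5 : 0 < 1 - success p q (x + n) (y + n) - success q p (y + n) (x + n) := by
      have h5 : 0 < (1 - p) * (1 - q) := mul_pos (by linarith) (by linarith)
      have h6 : 0 < p * q := mul_pos hp.1 hq.1
      unfold success
      split_ifs <;> nlinarith
    have : slotProb p q l m (x + n, y + n) (0, true, true) =
      (1 - success p q (x + n) (y + n) - success q p (y + n) (x + n)) * (l * m) := by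
      simp [slotProb]
    rw [this]
    exact mul_pos h5 (mul_pos hl.1 hm.1)

lemma kernel_slot_swap (s t : ℕ × ℕ) :
    kernel (slotProb q p m l) slotStep s.swap t.swap = kernel (slotProb p q l m) slotStep s t := by
  obtain ⟨x, y⟩ := s
  obtain ⟨x', y'⟩ := t
  have hc (a b : ℕ) : (a = y' ∧ b = x') ↔ (b = x' ∧ a = y') := and_comm
  simp only [kernel, slotProb, slotStep, Fintype.sum_prod_type, Fin.sum_univ_three,
    Fintype.sum_bool, Prod.swap, Prod.mk.injEq, hc]
  simp
  ring_nf

lemma exists_isStationary_slot_swap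
    (h : ∃ π, IsStationary (kernel (slotProb q p m l) slotStep) π) :
    ∃ π, IsStationary (kernel (slotProb p q l m) slotStep) π := by
  obtain ⟨π, h0, h1, h2⟩ := h
  refine ⟨fun s => π s.swap, fun s => h0 _, (Equiv.prodComm ℕ ℕ).hasSum_iff.2 h1, fun t => ?_⟩
  have := (Equiv.prodComm ℕ ℕ).hasSum_iff.2 (h2 t.swap)
  refine this.congr_fun ?_ |> fun h => h
  intro s
  simp [Function.comp, kernel_slot_swap]

lemma two_sub_le_one {a b : ℝ} (ha : 0 < a ∧ a < 1) (hb : 0 < b ∧ b < 1) :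
    a + b - 2 * a * b ≤ 1 := by
  nlinarith [mul_pos ha.1 hb.1, mul_pos (sub_pos.2 ha.2) (sub_pos.2 hb.2)]

/-- A quadratic function is a Lyapunov function of a stable network. -/
lemma exists_isStationary_slot (hp : 0 < p ∧ p < 1) (hq : 0 < q ∧ q < 1) (hl : 0 < l ∧ l < 1)
    (hm : 0 < m ∧ m < 1) (h1 : m < q * (1 - p)) (h2 : l < p * (1 - m / (1 - p))) :
    ∃ π, IsStationary (kernel (slotProb p q l m) slotStep) π := by
  obtain ⟨hp0, hp1⟩ := hp
  obtain ⟨hq0, hq1⟩ := hq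
  obtain ⟨hl0, hl1⟩ := hl
  obtain ⟨hm0, hm1⟩ := hm
  have hp' : 0 < 1 - p := by linarith
  have hq' : 0 < 1 - q := by linarith
  -- With this weight `x + c * y` has the same drift `l - p + c * m = -e` in the interior and on the
  -- axis `y = 0`: the service lost by the first queue to interference is exactly compensated by the
  -- service of the second.
  obtain ⟨c, hc⟩ : ∃ c, c = p / (1 - p) := ⟨_, rfl⟩
  have hc0 : 0 < c := hc ▸ div_pos hp0 hp'
  have hcp : c * (1 - p) = p := by rw [hc]; field_simp
  obtain ⟨e, he⟩ : ∃ e, e = p - l - c * m := ⟨_, rfl⟩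
  have he0 : 0 < e := by
    have : p * (1 - m / (1 - p)) = p - c * m := by rw [hc]; ring
    linarith
  obtain ⟨d, hd⟩ : ∃ d, d = q * (1 - p) - m := ⟨_, rfl⟩
  have hd0 : 0 < d := by linarith
  -- On the axis `x = 0` the weighted sum may drift upwards. There `y` has drift at most `-d`, and
  -- the term `K * y ^ 2` is large enough to bring the coefficient of `2 * y` below `-1`.
  obtain ⟨K, hK⟩ : ∃ K, K = (c * (1 + c) + 1) / d := ⟨_, rfl⟩
  have hK0 : 0 < K := by rw [hK]; positivity
  have hKd : K * d = c * (1 + c) + 1 := by rw [hK]; field_simp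
  obtain ⟨B, hB⟩ : ∃ B, B = (1 + c) ^ 2 + K := ⟨_, rfl⟩
  have hB0 : 0 < B := by rw [hB]; positivity
  have hl2 : l = p - c * m - e := by linarith
  have hm2 : m = q * (1 - p) - d := by linarith
  obtain ⟨k, hk0, hke, hkc, hk1⟩ : ∃ k : ℝ, 0 < k ∧ k ≤ 2 * e ∧ k ≤ 2 * e * c ∧ k ≤ 2 :=
    ⟨min (min (2 * e) (2 * e * c)) 2, by positivity,
      (min_le_left _ _).trans (min_le_left _ _), (min_le_left _ _).trans (min_le_right _ _),
      min_le_right _ _⟩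
  let V : ℕ × ℕ → ℝ := fun s => ((s.1 : ℝ) + c * s.2) ^ 2 + K * (s.2 : ℝ) ^ 2
  have drift (s : ℕ × ℕ) :
      avg (slotProb p q l m) slotStep V s ≤ V s - k * ((s.1 : ℝ) + s.2) + B := by
    obtain ⟨x, y⟩ := s
    rcases x with _ | x <;> rcases y with _ | y
    · rw [avg_slot_zero_zero]
      have e1 : arrivalMean l m V 0 0 = l + c ^ 2 * m + 2 * c * (l * m) + K * m := by
        simp only [arrivalMean, V]; push_cast; ring
      have e2 : V (0, 0) = 0 := by simp [V]
      simp only [e1, e2, Nat.cast_zero]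
      have a4 := mul_le_mul_of_nonneg_left
        (mul_lt_one_of_nonneg_of_lt_one_left hl0.le hl1 hm1.le).le hc0.le
      have a10 := mul_lt_mul_of_pos_left hm1 (pow_pos hc0 2)
      have a11 := mul_lt_mul_of_pos_left hm1 hK0
      linarith
    · rw [avg_slot_zero_succ]
      have e1 : q * arrivalMean l m V 0 y + (1 - q) * arrivalMean l m V 0 (y + 1) =
          V (0, y + 1) + 2 * (y + 1) * (c * (l + c * (m - q)) + K * (m - q)) +
          (l + c ^ 2 * (m + q - 2 * m * q) + 2 * c * (l * (m - q)) + K * (m + q - 2 * m * q)) := by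
        simp only [arrivalMean, V]; push_cast; ring
      rw [e1]
      push_cast
      have hy : (0 : ℝ) ≤ y := Nat.cast_nonneg y
      have a1 := two_sub_le_one ⟨hm0, hm1⟩ ⟨hq0, hq1⟩
      have a2 : m - q ≤ -d := by linarith [mul_pos hp0 hq0]
      have a3 : c * (l + c * (m - q)) + K * (m - q) ≤ -1 := by
        have b1 : l + c * (m - q) ≤ 1 + c := by
            have := mul_nonneg hc0.le (by linarith : 0 ≤ q - m)
            linarith
        have b2 := mul_le_mul_of_nonneg_left b1 hc0.le
        have b3 := mul_le_mul_of_nonneg_left a2 hK0.le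
        linarith
      have a4 : l * (m - q) ≤ 1 := by
        have := mul_nonneg hl0.le (by linarith : 0 ≤ q - m)
        linarith
      have a5 := mul_le_mul_of_nonneg_left a1 hK0.le
      have a6 := mul_le_mul_of_nonneg_left a1 (sq_nonneg c)
      have a7 := mul_le_mul_of_nonneg_left a4 hc0.le
      have a8 := mul_le_mul_of_nonneg_left a3 (by linarith : (0 : ℝ) ≤ 2 * (y + 1))
      have a9 := mul_le_mul_of_nonneg_right hk1 (by linarith : (0 : ℝ) ≤ y + 1)
      linarith
    · rw [avg_slot_succ_zero]
      have e1 : p * arrivalMean l m V x 0 + (1 - p) * arrivalMean l m V (x + 1) 0 =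
          V (x + 1, 0) - 2 * (x + 1) * e +
          ((l + p - 2 * l * p) + c ^ 2 * m + 2 * c * ((l - p) * m) + K * m) := by
        rw [he]; simp only [arrivalMean, V]; push_cast; ring
      rw [e1]
      push_cast
      have hx : (0 : ℝ) ≤ x := Nat.cast_nonneg x
      have a1 := two_sub_le_one ⟨hl0, hl1⟩ ⟨hp0, hp1⟩
      have a4 : (l - p) * m ≤ 1 := by
        have : (l - p) * m ≤ 1 * m := mul_le_mul_of_nonneg_right (by linarith) hm0.le
        linarith
      have a7 := mul_le_mul_of_nonneg_left a4 hc0.le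
      have a9 := mul_le_mul_of_nonneg_right hke (by linarith : (0 : ℝ) ≤ x + 1)
      have a10 := mul_lt_mul_of_pos_left hm1 (pow_pos hc0 2)
      have a11 := mul_lt_mul_of_pos_left hm1 hK0
      linarith
    · rw [avg_slot_succ_succ]
      have e1 : p * (1 - q) * arrivalMean l m V x (y + 1) +
          q * (1 - p) * arrivalMean l m V (x + 1) y +
          (1 - p * (1 - q) - q * (1 - p)) * arrivalMean l m V (x + 1) (y + 1) =
          V (x + 1, y + 1) - 2 * ((x + 1) + c * (y + 1)) * e +
          ((l + p * (1 - q) - 2 * l * (p * (1 - q))) +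
            c ^ 2 * (m + q * (1 - p) - 2 * m * (q * (1 - p))) +
            2 * c * (l * m - l * (q * (1 - p)) - m * (p * (1 - q))) +
            K * (-2 * (y + 1) * d + (m + q * (1 - p) - 2 * m * (q * (1 - p))))) := by
        rw [he, hd]; simp only [arrivalMean, V]; push_cast
        linear_combination (-(2 * ((x : ℝ) + 1 + c * (y + 1)) * q)) * hcp
      rw [e1]
      push_cast
      have hx : (0 : ℝ) ≤ x := Nat.cast_nonneg x
      have hy : (0 : ℝ) ≤ y := Nat.cast_nonneg y
      have s0 : 0 < p * (1 - q) ∧ p * (1 - q) < 1 := ⟨by positivity, by nlinarith⟩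
      have s1 : 0 < q * (1 - p) ∧ q * (1 - p) < 1 := ⟨by positivity, by nlinarith⟩
      have a1 := two_sub_le_one ⟨hl0, hl1⟩ s0
      have a2 := two_sub_le_one ⟨hm0, hm1⟩ s1
      have a4 : l * m - l * (q * (1 - p)) - m * (p * (1 - q)) ≤ 1 := by
        linarith [mul_pos hl0 s1.1, mul_pos hm0 s0.1,
          mul_lt_one_of_nonneg_of_lt_one_left hl0.le hl1 hm1.le]
      have key (R₁ R₂ R₃ : ℝ) (h1 : R₁ ≤ 1) (h2 : R₂ ≤ 1) (h3 : R₃ ≤ 1) :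
          - (2 * ((x + 1) + c * (y + 1)) * e) + (R₁ + c ^ 2 * R₂ + 2 * c * R₃ +
            K * (-2 * (y + 1) * d + R₂)) ≤ - (k * ((x + 1) + (y + 1))) + B := by
        clear e1 a1 a2 a4 s0 s1
        have a5 := mul_le_mul_of_nonneg_left h2 hK0.le
        have a6 := mul_le_mul_of_nonneg_left h2 (sq_nonneg c)
        have a7 := mul_le_mul_of_nonneg_left h3 hc0.le
        have a8 : 0 ≤ K * (2 * (y + 1) * d) := by positivity
        have a9 := mul_le_mul_of_nonneg_right hke (by linarith : (0 : ℝ) ≤ x + 1)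
        have a10 := mul_le_mul_of_nonneg_right hkc (by linarith : (0 : ℝ) ≤ y + 1)
        rw [hB]
        linear_combination h1 + a5 + a6 + 2 * a7 + a8 + a9 + a10
      linear_combination key _ _ _ a1 a2 a4
  obtain ⟨N, hN⟩ := exists_nat_gt ((B + 1) / k)
  refine exists_isStationary_of_drift (slotProb_nonneg ⟨hp0, hp1⟩ ⟨hq0, hq1⟩ ⟨hl0, hl1⟩ ⟨hm0, hm1⟩)
    sum_slotProb (V := V) (fun s => by positivity) (Finset.range N ×ˢ Finset.range N) (0, 0)
    (b := B + 1) fun s => (drift s).trans ?_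
  rw [Finset.sum_ite_eq]
  split_ifs with h
  · have : 0 ≤ k * ((s.1 : ℝ) + s.2) := by positivity
    linear_combination this
  · have : (N : ℝ) ≤ (s.1 : ℝ) + s.2 := by
      have : N ≤ s.1 + s.2 := by
        simp only [Finset.mem_product, Finset.mem_range] at h
        omega
      exact_mod_cast this
    rw [div_lt_iff₀ hk0] at hN
    linear_combination hN + k * this

end

/-! ### Instability when the second queue is stable against a saturated first queue -/

section

variable {p q l m : ℝ}

/-- A non-empty second queue succeeds with probability at least `q * (1 - p)` whatever the first
does, so `y ^ 2` has drift at most `-2 * d * y + 1`. The finite mean of `y` is what controls the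
steps of the unbounded function used below. -/
lemma IsStationary.summable_snd (hp : 0 < p ∧ p < 1) (hq : 0 < q ∧ q < 1) (hl : 0 < l ∧ l < 1)
    (hm : 0 < m ∧ m < 1) (h1 : m < q * (1 - p)) {π : ℕ × ℕ → ℝ}
    (hπ : IsStationary (kernel (slotProb p q l m) slotStep) π) :
    Summable fun s => π s * (1 + (s.2 : ℝ)) := by
  obtain ⟨d, hd⟩ : ∃ d, d = q * (1 - p) - m := ⟨_, rfl⟩
  have hd0 : 0 < d := by linarith
  have hpq := mul_pos hp.1 hq.1
  have h := hπ.summable_of_drift (slotProb_nonneg hp hq hl hm) sum_slotProb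
    (V := fun s => (s.2 : ℝ) ^ 2) (g := fun s => 2 * d * (s.2 : ℝ)) (C := 1)
    (fun s => by positivity) (fun s => by positivity) zero_le_one ?_
  · have := hπ.2.1.summable.add (h.mul_left (1 / (2 * d)))
    refine this.congr fun s => ?_
    field_simp
  · rintro ⟨x, y⟩
    rcases x with _ | x <;> rcases y with _ | y
    · rw [avg_slot_zero_zero]
      simp only [arrivalMean]; push_cast; linear_combination hm.2
    · rw [avg_slot_zero_succ]
      have e : q * arrivalMean l m (fun s => (s.2 : ℝ) ^ 2) 0 y +
          (1 - q) * arrivalMean l m (fun s => (s.2 : ℝ) ^ 2) 0 (y + 1) =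
          (y + 1 : ℝ) ^ 2 - 2 * d * (y + 1) - 2 * (y + 1) * (p * q) + (m + q - 2 * m * q) := by
        rw [hd]; simp only [arrivalMean]; push_cast; ring
      rw [e]; push_cast
      have : 0 ≤ 2 * ((y : ℝ) + 1) * (p * q) := by positivity
      linear_combination this + two_sub_le_one hm hq
    · rw [avg_slot_succ_zero]
      simp only [arrivalMean]; push_cast; linear_combination hm.2
    · rw [avg_slot_succ_succ]
      have e : p * (1 - q) * arrivalMean l m (fun s => (s.2 : ℝ) ^ 2) x (y + 1) +
          q * (1 - p) * arrivalMean l m (fun s => (s.2 : ℝ) ^ 2) (x + 1) y +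
          (1 - p * (1 - q) - q * (1 - p)) *
            arrivalMean l m (fun s => (s.2 : ℝ) ^ 2) (x + 1) (y + 1) =
          (y + 1 : ℝ) ^ 2 - 2 * d * (y + 1) + (m + q * (1 - p) - 2 * m * (q * (1 - p))) := by
        rw [hd]; simp only [arrivalMean]; push_cast; ring
      rw [e]; push_cast
      have s1 : 0 < q * (1 - p) ∧ q * (1 - p) < 1 :=
        ⟨mul_pos hq.1 (by linarith), by linarith⟩
      linear_combination two_sub_le_one hm s1

/-- Step bound for quadratic functions of the queue lengths. -/
lemma sq_quadratic_step_le {a b c e f : ℝ} {x y dx dy : ℝ} (hx : 0 ≤ x) (hy : 0 ≤ y)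
    (hxy : 1 ≤ x + y) (hdx : |dx| ≤ 1) (hdy : |dy| ≤ 1) :
    (a * (x + dx) ^ 2 + b * ((x + dx) * (y + dy)) + c * (y + dy) ^ 2 + e * (x + dx) + f * (y + dy) -
      (a * x ^ 2 + b * (x * y) + c * y ^ 2 + e * x + f * y)) ^ 2 ≤
      (3 * (|a| + |b| + |c| + |e| + |f|)) ^ 2 * (x + y) ^ 2 := by
  rw [← mul_pow, ← sq_abs]
  refine pow_le_pow_left₀ (abs_nonneg _) ?_ 2
  have e0 : a * (x + dx) ^ 2 + b * ((x + dx) * (y + dy)) + c * (y + dy) ^ 2 + e * (x + dx) +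
      f * (y + dy) - (a * x ^ 2 + b * (x * y) + c * y ^ 2 + e * x + f * y) =
      a * (2 * x * dx + dx * dx) + b * (x * dy + y * dx + dx * dy) + c * (2 * y * dy + dy * dy) +
        e * dx + f * dy := by ring
  have hxx : |dx * dx| ≤ 1 := by rw [abs_mul]; exact mul_le_one₀ hdx (abs_nonneg _) hdx
  have hxy' : |dx * dy| ≤ 1 := by rw [abs_mul]; exact mul_le_one₀ hdx (abs_nonneg _) hdy
  have hyy : |dy * dy| ≤ 1 := by rw [abs_mul]; exact mul_le_one₀ hdy (abs_nonneg _) hdy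
  have k1 : |x * dx| ≤ x := by rw [abs_mul, abs_of_nonneg hx]; exact mul_le_of_le_one_right hx hdx
  have k2 : |x * dy| ≤ x := by rw [abs_mul, abs_of_nonneg hx]; exact mul_le_of_le_one_right hx hdy
  have k3 : |y * dx| ≤ y := by rw [abs_mul, abs_of_nonneg hy]; exact mul_le_of_le_one_right hy hdx
  have k4 : |y * dy| ≤ y := by rw [abs_mul, abs_of_nonneg hy]; exact mul_le_of_le_one_right hy hdy
  rw [abs_le] at hxx hxy' hyy k1 k2 k3 k4 hdx hdy
  have t (a u : ℝ) (h : |u| ≤ 3 * (x + y)) : |a * u| ≤ |a| * (3 * (x + y)) := by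
    rw [abs_mul]; exact mul_le_mul_of_nonneg_left h (abs_nonneg a)
  have t1 := t a (2 * x * dx + dx * dx) (abs_le.2 ⟨by linarith, by linarith⟩)
  have t2 := t b (x * dy + y * dx + dx * dy) (abs_le.2 ⟨by linarith, by linarith⟩)
  have t3 := t c (2 * y * dy + dy * dy) (abs_le.2 ⟨by linarith, by linarith⟩)
  have t4 := t e dx (abs_le.2 ⟨by linarith, by linarith⟩)
  have t5 := t f dy (abs_le.2 ⟨by linarith, by linarith⟩)
  rw [e0]
  refine (abs_add_le _ _).trans ?_
  refine (add_le_add_left (abs_add_le _ _) _).trans ?_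
  refine (add_le_add_left (add_le_add_left (abs_add_le _ _) _) _).trans ?_
  refine (add_le_add_left (add_le_add_left (add_le_add_left (abs_add_le _ _) _) _) _).trans ?_
  linear_combination t1 + t2 + t3 + t4 + t5

/-- If the second queue is stable when the first one is saturated, but the rate of the first one
is too large, then there is no stationary distribution. -/
lemma not_exists_isStationary_slot_of_lt (hp : 0 < p ∧ p < 1) (hq : 0 < q ∧ q < 1)
    (hl : 0 < l ∧ l < 1) (hm : 0 < m ∧ m < 1) (h1 : m < q * (1 - p))
    (h2 : p * (1 - m / (1 - p)) ≤ l) :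
    ¬ ∃ π, IsStationary (kernel (slotProb p q l m) slotStep) π := by
  rintro ⟨π, hπ⟩
  have hp' : 0 < 1 - p := by linarith
  have hq' : 0 < 1 - q := by linarith
  have hp0 := hp.1
  have hq0 := hq.1
  have hm0 := hm.1
  obtain ⟨c, hc⟩ : ∃ c, c = p / (1 - p) := ⟨_, rfl⟩
  have hc0 : 0 < c := hc ▸ div_pos hp0 hp'
  have hcp : c * (1 - p) = p := by rw [hc]; field_simp
  obtain ⟨ε, hε⟩ : ∃ ε, ε = l - p + c * m := ⟨_, rfl⟩
  have hε0 : 0 ≤ ε := by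
    have : p * (1 - m / (1 - p)) = p - c * m := by rw [hc]; ring
    linarith
  -- At the critical rate, `ε = 0`, the first queue drifts by `-t` when alone and by `τ = p * q - t
  -- > 0` when both are busy.
  obtain ⟨t, ht⟩ : ∃ t, t = c * m := ⟨_, rfl⟩
  have ht0 : 0 < t := ht ▸ mul_pos hc0 hm0
  have htpq : t < p * q := by
    have := mul_lt_mul_of_pos_left h1 hc0
    rw [ht]; linear_combination this + q * hcp
  have htp : t < p := htpq.trans (by nlinarith)
  have hl' : l = p - t + ε := by rw [hε, ht]; ring
  have hb0 : 0 < 2 * p * (1 - p) + t * (2 * p - 1 + c) - 2 * t ^ 2 := by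
    have e1 : c * (1 - t) = c * (1 - p) + c * (p - t) := by ring
    have k : 0 < (2 * p * (1 - p) + t * (2 * p - 1 + c) - 2 * t ^ 2) * (1 - p) := by
      have : (2 * p * (1 - p) + t * (2 * p - 1 + c) - 2 * t ^ 2) * (1 - p) =
        2 * p * (1 - p) ^ 2 + t * (2 * p - 1) * (1 - p) + t * p - 2 * t ^ 2 * (1 - p) := by
        linear_combination t * hcp
      rw [this]
      have u1 : 0 < (p - t) * t * (1 - p) := by
        have := sub_pos.2 htp
        positivity
      have u2 : 0 < (p - t) * (1 - p) ^ 2 := mul_pos (sub_pos.2 htp) (by positivity)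
      nlinarith [mul_pos ht0 hp0, mul_pos ht0 hp', sq_nonneg (1 - 2 * p),
        mul_nonneg ht0.le (sq_nonneg (1 - 2 * p)), mul_pos (sub_pos.2 htp) hp0]
    exact (mul_pos_iff_of_pos_right hp').1 k
  have hb1 : 0 < 2 * (p * (1 - q)) * (1 - p) := by positivity
  -- This is `(x + c * y) ^ 2 - (c * y) ^ 2 - c * x`. It vanishes for `x = 0`, so a large value
  -- excludes the axis on which the weighted sum may drift downwards. The linear term adds `c * t`
  -- to the drift for `y = 0`, whose constant part could otherwise be negative; its cost `c * τ` in
  -- the interior is covered by `2 * c * y * τ` with `y ≥ 1`.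
  set F : ℕ × ℕ → ℝ := fun s =>
    1 * (s.1 : ℝ) ^ 2 + 2 * c * ((s.1 : ℝ) * s.2) + 0 * (s.2 : ℝ) ^ 2 + (-c) * s.1 + 0 * s.2 with hF
  have hx1 (s : ℕ × ℕ) (h : 1 < F s) : 1 ≤ s.1 := by
    by_contra h'
    have : s.1 = 0 := by omega
    simp [hF, this] at h
    linarith
  have hdrift (s : ℕ × ℕ) (h : 1 < F s) : F s + min (2 * p * (1 - p) + t * (2 * p - 1 + c) -
      2 * t ^ 2) (2 * (p * (1 - q)) * (1 - p)) ≤ avg (slotProb p q l m) slotStep F s := by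
    have hx := hx1 s h
    obtain ⟨x, y⟩ := s
    rcases x with _ | x
    · simp at hx
    have hx0 : (0 : ℝ) ≤ x := Nat.cast_nonneg x
    rcases y with _ | y
    · have e : p * arrivalMean l m F x 0 + (1 - p) * arrivalMean l m F (x + 1) 0 =
          F (x + 1, 0) + (2 * p * (1 - p) + t * (2 * p - 1 + c) - 2 * t ^ 2) +
            ε * (2 * (x + 1) + 1 - 2 * p + 2 * t - c) := by
        rw [hε, ht]; simp only [arrivalMean, hF]; push_cast
        ring
      rw [avg_slot_succ_zero, e]
      have hxc : c < x + 1 := by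
        simp only [hF] at h
        push_cast at h
        by_contra! h'
        nlinarith
      have : 0 ≤ ε * (2 * (x + 1) + 1 - 2 * p + 2 * t - c) := mul_nonneg hε0 (by linarith)
      have := min_le_left (2 * p * (1 - p) + t * (2 * p - 1 + c) - 2 * t ^ 2)
        (2 * (p * (1 - q)) * (1 - p))
      linarith
    · have hy0 : (0 : ℝ) ≤ y := Nat.cast_nonneg y
      obtain ⟨τ, hτ⟩ : ∃ τ, τ = p * q - t := ⟨_, rfl⟩
      have hτ0 : 0 < τ := by linarith
      have e : p * (1 - q) * arrivalMean l m F x (y + 1) +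
          q * (1 - p) * arrivalMean l m F (x + 1) y +
          (1 - p * (1 - q) - q * (1 - p)) * arrivalMean l m F (x + 1) (y + 1) =
          F (x + 1, y + 1) + 2 * (p * (1 - q)) * (1 - p) +
            (τ * (1 + c - 2 * (p * (1 - q)) - 2 * τ) + 2 * c * y * τ +
            ε * (2 * (x + 1) + c * (2 * y + 1) + 1 - 2 * (p * (1 - q)) - 2 * τ)) := by
        rw [hτ, hε, ht]; simp only [arrivalMean, hF]; push_cast
        linear_combination (-(2 * ((x : ℝ) + 1) * q) - 2 * l * q) * hcp
      rw [avg_slot_succ_succ, e]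
      have a1 : 0 ≤ τ * (1 + c - 2 * (p * (1 - q)) - 2 * τ) := by
        refine mul_nonneg hτ0.le ?_
        have : 2 * p ≤ 1 + c := by
          rw [hc, ← sub_nonneg]
          have : 1 + p / (1 - p) - 2 * p = (p ^ 2 + (1 - p) ^ 2) / (1 - p) := by
            field_simp; ring
          rw [this]; positivity
        linarith
      have a2 : 0 ≤ 2 * c * y * τ := by positivity
      have a3 : 0 ≤ ε * (2 * (x + 1) + c * (2 * y + 1) + 1 - 2 * (p * (1 - q)) - 2 * τ) := by
        refine mul_nonneg hε0 ?_
        have : 0 ≤ c * (2 * y + 1) := by positivity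
        linarith
      have := min_le_right (2 * p * (1 - p) + t * (2 * p - 1 + c) - 2 * t ^ 2)
        (2 * (p * (1 - q)) * (1 - p))
      linarith
  obtain ⟨k, hk0, hk1, hk2⟩ : ∃ k : ℝ, 0 < k ∧ k ≤ 1 / 2 ∧ k ≤ 2 * c :=
    ⟨min (1 / 2) (2 * c), by positivity, min_le_left _ _, min_le_right _ _⟩
  obtain ⟨A, hA⟩ : ∃ A : ℝ, A = (3 * (|1| + |2 * c| + |0| + |(-c)| + |0|)) ^ 2 := ⟨_, rfl⟩
  have hA0 : 0 ≤ A := hA ▸ sq_nonneg _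
  -- Steps are of order `x + y`, while `F` controls only `x * (x + y)`, not `y ^ 2`. As `x ≥ 1`, the
  -- missing factor is at most `1 + y`, which has a finite stationary mean.
  have hstep (s : ℕ × ℕ) (h : 1 < F s) (i : Fin 3 × Bool × Bool) : (F (slotStep s i) - F s) ^ 2 ≤
      (A * ((1 + c ^ 2 / 2) / k)) * (1 + (s.2 : ℝ)) * F s := by
    have hx : (1 : ℝ) ≤ s.1 := by exact_mod_cast hx1 s h
    have hy : (0 : ℝ) ≤ s.2 := Nat.cast_nonneg _
    have hn := slotStep_near s i
    have := sq_quadratic_step_le (a := 1) (b := 2 * c) (c := 0) (e := -c) (f := 0)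
      (by linarith : (0 : ℝ) ≤ s.1) hy (by linarith) hn.1 hn.2
    simp only [add_sub_cancel] at this
    rw [← hA] at this
    refine this.trans ?_
    have h3 : ((s.1 : ℝ) + s.2) ^ 2 ≤ (1 + c ^ 2 / 2) / k * (1 + s.2) * F s := by
      rw [div_mul_eq_mul_div, div_mul_eq_mul_div, le_div_iff₀ hk0]
      have u1 : k * ((s.1 : ℝ) * (s.1 + s.2)) ≤ (1 + c ^ 2 / 2) * F s := by
        have v1 : (s.1 : ℝ) ^ 2 / 2 + 2 * c * (s.1 * s.2) - c ^ 2 / 2 ≤ F s := by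
          simp only [hF]
          linear_combination (1 / 2) * sq_nonneg ((s.1 : ℝ) - c)
        have v2 : c ^ 2 / 2 ≤ c ^ 2 / 2 * F s := le_mul_of_one_le_right (by positivity) h.le
        have v3 := mul_le_mul_of_nonneg_right hk1 (sq_nonneg (s.1 : ℝ))
        have v4 := mul_le_mul_of_nonneg_right hk2 (by positivity : (0 : ℝ) ≤ s.1 * s.2)
        linear_combination v1 + v2 + v3 + v4
      have u2 : ((s.1 : ℝ) + s.2) ^ 2 ≤ (s.1 * (s.1 + s.2)) * (1 + s.2) := by
        have : (s.1 : ℝ) + s.2 ≤ s.1 * (1 + s.2) := by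
          linear_combination mul_nonneg hy (sub_nonneg.2 hx)
        linear_combination ((s.1 : ℝ) + s.2) * this
      have u3 := mul_le_mul_of_nonneg_right u1 (by linarith : (0 : ℝ) ≤ 1 + s.2)
      have u4 := mul_le_mul_of_nonneg_left u2 hk0.le
      linear_combination u3 + u4
    linear_combination A * h3
  obtain ⟨x, y, hxy⟩ := hπ.exists_pos_diag hp hq hl hm
  -- Far enough along the diagonal `x ^ 2 - c * x` alone exceeds 1.
  obtain ⟨n, hn⟩ := exists_nat_gt (c + 1)
  refine (hxy (n + 1)).ne' (hπ.eq_zero_of_drift (slotProb_nonneg hp hq hl hm) sum_slotProb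
    one_pos (lt_min hb0 hb1) (fun s => ?_) ?_ hdrift hstep ?_)
  · positivity
  · refine ((hπ.summable_snd hp hq hl hm h1).mul_left (A * ((1 + c ^ 2 / 2) / k))).congr fun s => ?_
    ring
  · simp only [hF]
    push_cast
    have hx : (0 : ℝ) ≤ x := Nat.cast_nonneg x
    have hy : (0 : ℝ) ≤ y := Nat.cast_nonneg y
    have a1 : 0 ≤ 2 * c * ((x + (n + 1)) * (y + (n + 1))) := by positivity
    nlinarith

end

/-! ### Instability when neither queue is stable against a saturated competitor -/

section

variable {p q l m : ℝ}

/-- The constant drift on an axis at the critical corner. The quadratic part suffices if `p + q ≤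
1`; otherwise it exceeds `-1`, and the linear correction adds exactly 1. -/
lemma axis_drift_pos (hp : 0 < p ∧ p < 1) (hq : 0 < q ∧ q < 1) {t : ℝ}
    (ht : (t = 0 ∧ p + q ≤ 1) ∨ t * (p + q - 1) = 1) :
    0 < (1 - p) * (3 - 2 * q - 2 * p * (1 - q + q ^ 2)) + t * (p + q - 1) := by
  have hp' : 0 < 1 - p := by linarith
  have hq' : 0 < 1 - q := by linarith
  have hp0 := hp.1
  have hq0 := hq.1
  have h1 : 0 < 1 - q + q ^ 2 := by positivity
  rcases ht with ⟨rfl, h⟩ | ht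
  · rw [zero_mul, add_zero]
    refine mul_pos hp' ?_
    have h2 : 0 ≤ (1 - q - p) * (1 - q + q ^ 2) := mul_nonneg (by linarith) h1.le
    have h3 : 0 ≤ (1 - q) * (q * (1 - q)) := by positivity
    linarith
  · rw [ht]
    have h2 : 0 ≤ (1 - p) * (1 - q + q ^ 2) := by positivity
    have h3 : -1 ≤ 3 - 2 * q - 2 * p * (1 - q + q ^ 2) := by
      have : q ^ 2 ≤ 1 := pow_le_one₀ hq0.le hq.2.le
      linarith
    have := mul_le_mul_of_nonneg_left h3 hp'.le
    linarith

set_option maxHeartbeats 800000 in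
/-- If each queue is unstable when the other one is saturated, then there is no stationary
distribution. -/
lemma not_exists_isStationary_slot_of_le (hp : 0 < p ∧ p < 1) (hq : 0 < q ∧ q < 1)
    (hl : 0 < l ∧ l < 1) (hm : 0 < m ∧ m < 1) (h1 : p * (1 - q) ≤ l) (h2 : q * (1 - p) ≤ m) :
    ¬ ∃ π, IsStationary (kernel (slotProb p q l m) slotStep) π := by
  rintro ⟨π, hπ⟩
  have hp' : 0 < 1 - p := by linarith
  have hq' : 0 < 1 - q := by linarith
  have hp0 := hp.1
  have hq0 := hq.1
  obtain ⟨t, ht0, ht⟩ : ∃ t : ℝ, 0 ≤ t ∧ ((t = 0 ∧ p + q ≤ 1) ∨ t * (p + q - 1) = 1) := by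
    rcases le_or_gt (p + q) 1 with h | h
    · exact ⟨0, le_rfl, Or.inl ⟨rfl, h⟩⟩
    · have : 0 < p + q - 1 := by linarith
      exact ⟨1 / (p + q - 1), by positivity, Or.inr (by field_simp)⟩
  have hb1 := axis_drift_pos hp hq ht
  have hb2 := axis_drift_pos (t := t) hq hp (by rwa [add_comm q p])
  have hb0 : 0 < 2 * ((1 - p) * (1 - q)) * (1 + (1 - p) * (1 - q)) := by positivity
  obtain ⟨b, hb, hbb1, hbb2, hbb0⟩ : ∃ b : ℝ, 0 < b ∧
      b ≤ (1 - p) * (3 - 2 * q - 2 * p * (1 - q + q ^ 2)) + t * (p + q - 1) ∧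
      b ≤ (1 - q) * (3 - 2 * p - 2 * q * (1 - p + p ^ 2)) + t * (q + p - 1) ∧
      b ≤ 2 * ((1 - p) * (1 - q)) * (1 + (1 - p) * (1 - q)) :=
    ⟨_, lt_min (lt_min hb1 hb2) hb0, (min_le_left _ _).trans (min_le_left _ _),
      (min_le_left _ _).trans (min_le_right _ _), min_le_right _ _⟩
  clear hb1 hb2 hb0 ht
  -- At the corner `l = p * (1 - q)`, `m = q * (1 - p)` the interior has no drift, and on the axis
  -- `y = 0` the drift is `(-p * q, q * (1 - p))`. This `A` makes it orthogonal to the gradient of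
  -- the quadratic part of `F`; `B` does the same on the other axis.
  obtain ⟨A, hA⟩ : ∃ A, A = (1 - p) / p := ⟨_, rfl⟩
  obtain ⟨B, hB⟩ : ∃ B, B = (1 - q) / q := ⟨_, rfl⟩
  have hA0 : 0 < A := hA ▸ div_pos hp' hp0
  have hB0 : 0 < B := hB ▸ div_pos hq' hq0
  -- At the corner the linear terms `-α * x - β * y` leave the interior drift unchanged and add `t *
  -- (p + q - 1)` on each axis.
  obtain ⟨α, hα⟩ : ∃ α, α = t / p := ⟨_, rfl⟩
  obtain ⟨β, hβ⟩ : ∃ β, β = t / q := ⟨_, rfl⟩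
  have hα0 : 0 ≤ α := hα ▸ div_nonneg ht0 hp0.le
  have hβ0 : 0 ≤ β := hβ ▸ div_nonneg ht0 hq0.le
  obtain ⟨M₀, hM₀⟩ : ∃ M₀, M₀ = l - p * (1 - q) := ⟨_, rfl⟩
  obtain ⟨M₁, hM₁⟩ : ∃ M₁, M₁ = m - q * (1 - p) := ⟨_, rfl⟩
  have hM₀0 : 0 ≤ M₀ := by linarith
  have hM₁0 : 0 ≤ M₁ := by linarith
  obtain ⟨k, hk0, hkA, hkB, hk1⟩ : ∃ k : ℝ, 0 < k ∧ k ≤ A ∧ k ≤ B ∧ k ≤ 1 :=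
    ⟨min (min A B) 1, lt_min (lt_min hA0 hB0) one_pos, (min_le_left _ _).trans (min_le_left _ _),
      (min_le_left _ _).trans (min_le_right _ _), min_le_right _ _⟩
  -- Once a coordinate exceeds `N`, the coefficients of the excess rates `M₀`, `M₁` in the drift are
  -- nonnegative, and the linear part of `F` is at most half of its quadratic lower bound.
  obtain ⟨N, hN⟩ := exists_nat_gt ((α + β + 2) * (1 + 1 / A + 1 / B + 2 / k))
  have hsum0 : 0 ≤ α + β + 2 := by positivity
  have hN1 : α + β + 2 ≤ N := by
    have : 0 ≤ (α + β + 2) * (1 / A + 1 / B + 2 / k) := by positivity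
    linarith
  have hNA : α + β + 2 ≤ A * N := by
    have h3 : (α + β + 2) * (1 / A) ≤ N := by
      have : 0 ≤ (α + β + 2) * (1 + 1 / B + 2 / k) := by positivity
      linarith
    have := mul_le_mul_of_nonneg_left h3 hA0.le
    rwa [mul_left_comm, mul_one_div_cancel hA0.ne', mul_one] at this
  have hNB : α + β + 2 ≤ B * N := by
    have h3 : (α + β + 2) * (1 / B) ≤ N := by
      have : 0 ≤ (α + β + 2) * (1 + 1 / A + 2 / k) := by positivity
      linarith
    have := mul_le_mul_of_nonneg_left h3 hB0.le
    rwa [mul_left_comm, mul_one_div_cancel hB0.ne', mul_one] at this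
  have hNk : 2 * (α + β) ≤ k * N := by
    have h3 : (α + β) * (2 / k) ≤ N := by
      have : 0 ≤ (α + β + 2) * (1 + 1 / A + 1 / B) + 2 * (2 / k) := by positivity
      linarith
    have := mul_le_mul_of_nonneg_left h3 hk0.le
    have e : k * ((α + β) * (2 / k)) = 2 * (α + β) := by field_simp
    linarith
  clear hN
  have hN0 : (0 : ℝ) < N := by linarith
  set F : ℕ × ℕ → ℝ := fun s =>
    A * (s.1 : ℝ) ^ 2 + 2 * ((s.1 : ℝ) * s.2) + B * (s.2 : ℝ) ^ 2 + (-α) * s.1 + (-β) * s.2 with hF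
  have hlow (s : ℕ × ℕ) :
      k * ((s.1 : ℝ) + s.2) ^ 2 - (α + β) * ((s.1 : ℝ) + s.2) ≤ F s := by
    have hx : (0 : ℝ) ≤ s.1 := Nat.cast_nonneg _
    have hy : (0 : ℝ) ≤ s.2 := Nat.cast_nonneg _
    have v1 := mul_le_mul_of_nonneg_right hkA (sq_nonneg (s.1 : ℝ))
    have v2 := mul_le_mul_of_nonneg_right hkB (sq_nonneg (s.2 : ℝ))
    have v3 := mul_le_mul_of_nonneg_right hk1 (mul_nonneg hx hy)
    simp only [hF]
    linear_combination v1 + v2 + 2 * v3 + mul_nonneg hα0 hy + mul_nonneg hβ0 hx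
  have hlarge (s : ℕ × ℕ) (h : (A + 2 + B) * (N : ℝ) ^ 2 < F s) : N < s.1 ∨ N < s.2 := by
    by_contra! h'
    have hx : (0 : ℝ) ≤ s.1 := Nat.cast_nonneg _
    have hy : (0 : ℝ) ≤ s.2 := Nat.cast_nonneg _
    have hx' : (s.1 : ℝ) ≤ N := by exact_mod_cast h'.1
    have hy' : (s.2 : ℝ) ≤ N := by exact_mod_cast h'.2
    have v1 := mul_le_mul_of_nonneg_left (pow_le_pow_left₀ hx hx' 2) hA0.le
    have v2 := mul_le_mul_of_nonneg_left (pow_le_pow_left₀ hy hy' 2) hB0.le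
    have v3 := mul_le_mul hx' hy' hy hN0.le
    refine h.not_ge ?_
    simp only [hF]
    linear_combination v1 + v2 + 2 * v3 + mul_nonneg hα0 hx + mul_nonneg hβ0 hy
  have hdrift (s : ℕ × ℕ) (h : (A + 2 + B) * (N : ℝ) ^ 2 < F s) :
      F s + b ≤ avg (slotProb p q l m) slotStep F s := by
    have hs := hlarge s h
    clear h hlow hlarge
    obtain ⟨x, y⟩ := s
    rcases x with _ | x <;> rcases y with _ | y
    · simp at hs
    · have hy0 : (0 : ℝ) ≤ y := Nat.cast_nonneg y
      have hy : (N : ℝ) ≤ y + 1 := by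
        simp only [not_lt_zero, false_or] at hs
        exact_mod_cast hs.le
      have e : q * arrivalMean l m F 0 y + (1 - q) * arrivalMean l m F 0 (y + 1) =
          F (0, y + 1) + ((1 - q) * (3 - 2 * p - 2 * q * (1 - p + p ^ 2)) + t * (q + p - 1)) +
            M₁ * (2 * B * (y + 1) + B * (1 - 2 * q) + 2 * l - β) +
            M₀ * (2 * (y + 1) - 2 * p * q + A - α) := by
        rw [hM₀, hM₁]; simp only [arrivalMean, hF]; push_cast
        rw [hA, hB, hα, hβ]; field_simp; ring
      rw [avg_slot_zero_succ, e]
      have v1 := mul_le_mul_of_nonneg_left hy hB0.le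
      have v2 : 0 ≤ M₁ * (2 * B * (y + 1) + B * (1 - 2 * q) + 2 * l - β) :=
        mul_nonneg hM₁0 (by linarith [mul_nonneg hB0.le hy0, mul_pos hB0 hq', hl.1])
      have v3 : 0 ≤ M₀ * (2 * (y + 1) - 2 * p * q + A - α) :=
        mul_nonneg hM₀0 (by linarith [mul_pos hp0 hq'])
      linarith
    · have hx0 : (0 : ℝ) ≤ x := Nat.cast_nonneg x
      have hx : (N : ℝ) ≤ x + 1 := by
        simp only [not_lt_zero, or_false] at hs
        exact_mod_cast hs.le
      have e : p * arrivalMean l m F x 0 + (1 - p) * arrivalMean l m F (x + 1) 0 =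
          F (x + 1, 0) + ((1 - p) * (3 - 2 * q - 2 * p * (1 - q + q ^ 2)) + t * (p + q - 1)) +
            M₀ * (2 * A * (x + 1) + A * (1 - 2 * p) + 2 * m - α) +
            M₁ * (2 * (x + 1) - 2 * p * q + B - β) := by
        rw [hM₀, hM₁]; simp only [arrivalMean, hF]; push_cast
        rw [hA, hB, hα, hβ]; field_simp; ring
      rw [avg_slot_succ_zero, e]
      have v1 := mul_le_mul_of_nonneg_left hx hA0.le
      have v2 : 0 ≤ M₀ * (2 * A * (x + 1) + A * (1 - 2 * p) + 2 * m - α) :=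
        mul_nonneg hM₀0 (by linarith [mul_nonneg hA0.le hx0, mul_pos hA0 hp', hm.1])
      have v3 : 0 ≤ M₁ * (2 * (x + 1) - 2 * p * q + B - β) :=
        mul_nonneg hM₁0 (by linarith [mul_pos hp0 hq'])
      linarith
    · have hx0 : (0 : ℝ) ≤ x := Nat.cast_nonneg x
      have hy0 : (0 : ℝ) ≤ y := Nat.cast_nonneg y
      have e : p * (1 - q) * arrivalMean l m F x (y + 1) +
          q * (1 - p) * arrivalMean l m F (x + 1) y +
          (1 - p * (1 - q) - q * (1 - p)) * arrivalMean l m F (x + 1) (y + 1) =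
          F (x + 1, y + 1) + 2 * ((1 - p) * (1 - q)) * (1 + (1 - p) * (1 - q)) +
            M₀ * (2 * A * (x + 1) + 2 * (y + 1) - α + A * (1 - 2 * (p * (1 - q))) + 2 * M₁) +
            M₁ * (2 * (x + 1) + 2 * B * (y + 1) - β + B * (1 - 2 * (q * (1 - p)))) := by
        rw [hM₀, hM₁]; simp only [arrivalMean, hF]; push_cast
        rw [hA, hB, hα, hβ]; field_simp; ring
      rw [avg_slot_succ_succ, e]
      have w1 : 0 < A * (1 - p * (1 - q)) := mul_pos hA0 (by linarith [mul_pos hp0 hq0])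
      have w2 : 0 < B * (1 - q * (1 - p)) := mul_pos hB0 (by linarith [mul_pos hp0 hq0])
      have w3 := mul_nonneg hA0.le hx0
      have w4 := mul_nonneg hB0.le hy0
      have w5 : 0 ≤ 2 * A * (x + 1) + 2 * (y + 1) - α + A * (1 - 2 * (p * (1 - q))) + 2 * M₁ ∧
          0 ≤ 2 * (x + 1) + 2 * B * (y + 1) - β + B * (1 - 2 * (q * (1 - p))) := by
        rcases hs with hs | hs
        · have hx : (N : ℝ) ≤ x + 1 := by exact_mod_cast hs.le
          have v1 := mul_le_mul_of_nonneg_left hx hA0.le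
          constructor <;> linarith
        · have hy : (N : ℝ) ≤ y + 1 := by exact_mod_cast hs.le
          have v1 := mul_le_mul_of_nonneg_left hy hB0.le
          constructor <;> linarith
      have v2 := mul_nonneg hM₀0 w5.1
      have v3 := mul_nonneg hM₁0 w5.2
      linarith
  obtain ⟨D, hD⟩ : ∃ D : ℝ, D = (3 * (|A| + |2| + |B| + |(-α)| + |(-β)|)) ^ 2 := ⟨_, rfl⟩
  have hD0 : 0 ≤ D := hD ▸ sq_nonneg _
  -- Here `F` grows like `(x + y) ^ 2` in every direction of the quadrant, so a constant `g`
  -- suffices and no moment of the queues is needed.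
  have hstep (s : ℕ × ℕ) (h : (A + 2 + B) * (N : ℝ) ^ 2 < F s) (i : Fin 3 × Bool × Bool) :
      (F (slotStep s i) - F s) ^ 2 ≤ (D * (2 / k)) * F s := by
    have hx : (0 : ℝ) ≤ s.1 := Nat.cast_nonneg _
    have hy : (0 : ℝ) ≤ s.2 := Nat.cast_nonneg _
    have hn : (N : ℝ) ≤ s.1 + s.2 := by
      have : N ≤ s.1 + s.2 := by
        have := hlarge s h
        omega
      exact_mod_cast this
    have hnear := slotStep_near s i
    have := sq_quadratic_step_le (a := A) (b := 2) (c := B) (e := -α) (f := -β)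
      hx hy (by linarith) hnear.1 hnear.2
    simp only [add_sub_cancel] at this
    rw [← hD] at this
    refine this.trans ?_
    rw [mul_assoc]
    refine mul_le_mul_of_nonneg_left ?_ hD0
    rw [div_mul_eq_mul_div, le_div_iff₀ hk0]
    have u1 := mul_le_mul_of_nonneg_right (hNk.trans (mul_le_mul_of_nonneg_left hn hk0.le))
      (by linarith : 0 ≤ (s.1 : ℝ) + s.2)
    linear_combination 2 * hlow s + u1
  obtain ⟨x, y, hxy⟩ := hπ.exists_pos_diag hp hq hl hm
  obtain ⟨n, hn⟩ := exists_nat_gt (((A + 2 + B) * (N : ℝ) ^ 2 + (α + β)) / k + 1)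
  refine (hxy n).ne' (hπ.eq_zero_of_drift (slotProb_nonneg hp hq hl hm) sum_slotProb
    (M := (A + 2 + B) * (N : ℝ) ^ 2) (by positivity) hb (g := fun _ => D * (2 / k))
    (fun s => by positivity) (hπ.2.1.summable.mul_right _) hdrift hstep ?_)
  refine lt_of_lt_of_le ?_ (hlow _)
  have hx : (0 : ℝ) ≤ x := Nat.cast_nonneg x
  have hy : (0 : ℝ) ≤ y := Nat.cast_nonneg y
  push_cast
  obtain ⟨u, hu⟩ : ∃ u : ℝ, u = x + n + (y + n) := ⟨_, rfl⟩
  rw [← hu]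
  have hM : 0 ≤ (A + 2 + B) * (N : ℝ) ^ 2 := by positivity
  have h3 : 0 ≤ ((A + 2 + B) * (N : ℝ) ^ 2 + (α + β)) / k := by positivity
  have hn' : ((A + 2 + B) * (N : ℝ) ^ 2 + (α + β)) / k < u := by linarith
  rw [div_lt_iff₀ hk0] at hn'
  have hu1 : 1 ≤ u := by linarith
  nlinarith

end

/-! ### Reduction of the exact network to the walk on `ℕ × ℕ`: the single backoff stage carries no
information -/

instance : Subsingleton (Fin (0 + 1)) := inferInstanceAs (Subsingleton (Fin 1))

lemma sum_bool_pairs {M : Type*} [AddCommMonoid M] (f : (Fin 2 → Bool) → M) :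
    ∑ a, f a = f ![false, false] + f ![true, false] + f ![false, true] + f ![true, true] := by
  rw [← (finTwoArrowEquiv Bool).symm.sum_comp, Fintype.sum_prod_type]
  simp only [Fintype.sum_bool, finTwoArrowEquiv_symm_apply]
  abel

lemma single_zero_eq : (single 0 : Fin 2 → Bool) = ![true, false] := by decide

lemma single_one_eq : (single 1 : Fin 2 → Bool) = ![false, true] := by decide

lemma arrivalProb_sub (l : ℝ) (z z' : ℕ) : arrivalProb l ((z' : ℤ) - z) =
    (1 - l) * (if z = z' then 1 else 0) + l * (if z + 1 = z' then 1 else 0) := by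
  have h1 : ((z' : ℤ) - z = 0) ↔ z = z' := by omega
  have h2 : ((z' : ℤ) - z = 1) ↔ z + 1 = z' := by omega
  simp only [arrivalProb, h1, h2]

lemma arrivalProb_cast (l : ℝ) (z' : ℕ) : arrivalProb l (z' : ℤ) =
    (1 - l) * (if 0 = z' then 1 else 0) + l * (if 1 = z' then 1 else 0) := by
  simpa using arrivalProb_sub l 0 z'

lemma arrivalProb_sub_succ (l : ℝ) (z z' : ℕ) : arrivalProb l ((z' : ℤ) - (z + 1)) =
    (1 - l) * (if z + 1 = z' then 1 else 0) + l * (if z + 1 + 1 = z' then 1 else 0) :=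
  mod_cast arrivalProb_sub l (z + 1) z'

lemma arrivalProb_sub_succ_add_one (l : ℝ) (z z' : ℕ) : arrivalProb l ((z' : ℤ) - (z + 1) + 1) =
    (1 - l) * (if z = z' then 1 else 0) + l * (if z + 1 = z' then 1 else 0) := by
  rw [← arrivalProb_sub]; congr 1; ring

/-- Without backoff, the states of the network of two nodes are pairs of queue lengths. -/
def netStateEquiv : ℕ × ℕ ≃ NetState 2 0 where
  toFun s := ⟨![(s.1, 0), (s.2, 0)], fun _ _ => Subsingleton.elim _ _⟩
  invFun s := ((s.1 0).1, (s.1 1).1)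
  left_inv _ := rfl
  right_inv s := by
    refine Subtype.ext (funext fun k => Prod.ext ?_ (Subsingleton.elim _ _))
    fin_cases k <;> rfl

lemma netStateEquiv_zero (s : ℕ × ℕ) : ((netStateEquiv s).1 0).1 = s.1 := rfl

lemma netStateEquiv_one (s : ℕ × ℕ) : ((netStateEquiv s).1 1).1 = s.2 := rfl

/-- Silence and collision both mean no departure and merge into one event of the slot; `r` enters
only to the power 0. -/
lemma netTrans_eq (p lam : Fin 2 → ℝ) (r : ℝ) (s t : ℕ × ℕ) :
    netTrans p r lam (netStateEquiv s) (netStateEquiv t) =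
      kernel (slotProb (p 0) (p 1) (lam 0) (lam 1)) slotStep s t := by
  obtain ⟨x, y⟩ := s
  obtain ⟨x', y'⟩ := t
  have hK (b : Fin 2 → Fin (0 + 1)) (a : Fin 2 → Bool) (b' : Fin 2 → Fin (0 + 1)) :
      (nextBackoff b a = b') = True := by
    simp only [eq_iff_iff, iff_true]; exact Subsingleton.elim _ _
  have hite (P Q : Prop) [Decidable P] [Decidable Q] :
      (if P ∧ Q then (1 : ℝ) else 0) = (if P then 1 else 0) * (if Q then 1 else 0) := by
    split_ifs <;> simp_all
  have hker : kernel (slotProb (p 0) (p 1) (lam 0) (lam 1)) slotStep (x, y) (x', y') =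
      ∑ i, slotProb (p 0) (p 1) (lam 0) (lam 1) (x, y) i *
        ((if (slotStep (x, y) i).1 = x' then 1 else 0) *
          (if (slotStep (x, y) i).2 = y' then 1 else 0)) := by
    unfold kernel
    refine Finset.sum_congr rfl fun i _ => ?_
    rw [← hite]
    congr 1
    simp only [Prod.ext_iff]
  rw [hker]
  simp only [netTrans, sum_bool_pairs, hK, if_true, attemptProb, Fin.prod_univ_two,
    netStateEquiv_zero, netStateEquiv_one, single_zero_eq, single_one_eq, slotProb, slotStep,
    Fintype.sum_prod_type, Fin.sum_univ_three, Fintype.sum_bool]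
  rcases x with _ | x <;> rcases y with _ | y <;>
    simp [success, arrivalProb_cast, arrivalProb_sub_succ, arrivalProb_sub_succ_add_one,
      -mul_ite, -ite_mul] <;>
    ring_nf

lemma IsStationary.congr_equiv {S S' : Type*} {P : S → S → ℝ} {P' : S' → S' → ℝ} (e : S ≃ S')
    (h : ∀ s t, P' (e s) (e t) = P s t) {π : S' → ℝ} (hπ : IsStationary P' π) :
    IsStationary P (π ∘ e) := by
  obtain ⟨h0, h1, h2⟩ := hπ
  refine ⟨fun s => h0 _, e.hasSum_iff.2 h1, fun t => ?_⟩
  have := e.hasSum_iff.2 (h2 (e t))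
  simpa [Function.comp_def, h] using this

lemma exists_isStationary_netTrans_iff (p lam : Fin 2 → ℝ) (r : ℝ) :
    (∃ π, IsStationary (netTrans (K := 0) p r lam) π) ↔
      ∃ π, IsStationary (kernel (slotProb (p 0) (p 1) (lam 0) (lam 1)) slotStep) π := by
  constructor
  · rintro ⟨π, hπ⟩
    exact ⟨_, hπ.congr_equiv netStateEquiv (netTrans_eq p lam r)⟩
  · rintro ⟨π, hπ⟩
    refine ⟨_, hπ.congr_equiv netStateEquiv.symm fun s t => ?_⟩
    rw [← netTrans_eq p lam r]
    simp

/-- The Rao–Ephremides region is the stability region of the two-node network. -/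
lemma mem_exactRegion_iff {p : Fin 2 → ℝ} (r : ℝ) (hp : ∀ k, 0 < p k ∧ p k < 1)
    (lam : Fin 2 → ℝ) (hl : ∀ k, 0 < lam k ∧ lam k < 1) :
    lam ∈ exactRegion 0 p r ↔
      ((lam 1 < p 1 * (1 - p 0) ∧ lam 0 < p 0 * (1 - lam 1 / (1 - p 0))) ∨
        (lam 0 < p 0 * (1 - p 1) ∧ lam 1 < p 1 * (1 - lam 0 / (1 - p 1)))) := by
  have e : lam ∈ exactRegion 0 p r ↔ ∃ π, IsStationary (netTrans (K := 0) p r lam) π :=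
    ⟨fun h => h.2, fun h => ⟨hl, h⟩⟩
  rw [e, exists_isStationary_netTrans_iff]
  constructor
  · intro h
    by_contra! h'
    rcases lt_or_ge (lam 1) (p 1 * (1 - p 0)) with h1 | h1
    · exact not_exists_isStationary_slot_of_lt (hp 0) (hp 1) (hl 0) (hl 1) h1 (h'.1 h1) h
    rcases lt_or_ge (lam 0) (p 0 * (1 - p 1)) with h2 | h2
    · exact not_exists_isStationary_slot_of_lt (hp 1) (hp 0) (hl 1) (hl 0) h2 (h'.2 h2)
        (exists_isStationary_slot_swap h)
    · exact not_exists_isStationary_slot_of_le (hp 0) (hp 1) (hl 0) (hl 1) h2 h1 h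
  · rintro (⟨h1, h2⟩ | ⟨h1, h2⟩)
    · exact exists_isStationary_slot (hp 0) (hp 1) (hl 0) (hl 1) h1 h2
    · exact exists_isStationary_slot_swap
        (exists_isStationary_slot (hp 1) (hp 0) (hl 1) (hl 0) h1 h2)

/-! ### The queue of a node when the other node is saturated -/

/-- Transition probabilities of a queue with Bernoulli arrivals of rate `l` and success
probability `s`. -/
noncomputable def queueTrans (l s : ℝ) (q t : ℕ) : ℝ :=
  (1 - if q = 0 then 0 else s) * arrivalProb l ((t : ℤ) - q) +
    (if q = 0 then 0 else s) * arrivalProb l ((t : ℤ) - q + 1)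

section Queue

variable {l s : ℝ}

lemma hasSum_queueTrans_zero (μ : ℕ → ℝ) :
    HasSum (fun q => μ q * queueTrans l s q 0) (μ 0 * (1 - l) + μ 1 * (s * (1 - l))) := by
  have e : (fun q => μ q * queueTrans l s q 0) = fun q =>
      (if q = 0 then μ 0 * (1 - l) else 0) + (if q = 1 then μ 1 * (s * (1 - l)) else 0) := by
    ext q
    rcases q with _ | q
    · simp [queueTrans, arrivalProb]
    · have h1 : ¬ ((0 : ℤ) - (q + 1) = 0) := by omega
      have h2 : ¬ ((0 : ℤ) - (q + 1) = 1) := by omega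
      have h3 : ((0 : ℤ) - (q + 1) + 1 = 0) ↔ q = 0 := by omega
      have h4 : ¬ ((0 : ℤ) - (q + 1) + 1 = 1) := by omega
      simp only [queueTrans, arrivalProb]
      push_cast
      simp only [h1, h2, h3, h4]
      by_cases h : q = 0 <;> simp [h]
  rw [e]
  exact (hasSum_ite_eq 0 _).add (hasSum_ite_eq 1 _)

lemma hasSum_queueTrans_succ (μ : ℕ → ℝ) (n : ℕ) :
    HasSum (fun q => μ q * queueTrans l s q (n + 1))
      (μ n * ((1 - if n = 0 then 0 else s) * l) +
        μ (n + 1) * ((1 - s) * (1 - l) + s * l) + μ (n + 2) * (s * (1 - l))) := by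
  have e : (fun q => μ q * queueTrans l s q (n + 1)) = fun q =>
      (if q = n then μ n * ((1 - if n = 0 then 0 else s) * l) else 0) +
        (if q = n + 1 then μ (n + 1) * ((1 - s) * (1 - l) + s * l) else 0) +
        (if q = n + 2 then μ (n + 2) * (s * (1 - l)) else 0) := by
    ext q
    have h1 : (((n + 1 : ℕ) : ℤ) - q = 0) ↔ q = n + 1 := by omega
    have h2 : (((n + 1 : ℕ) : ℤ) - q = 1) ↔ q = n := by omega
    have h3 : (((n + 1 : ℕ) : ℤ) - q + 1 = 0) ↔ q = n + 2 := by omega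
    have h4 : (((n + 1 : ℕ) : ℤ) - q + 1 = 1) ↔ q = n + 1 := by omega
    simp only [queueTrans, arrivalProb, h1, h2, h3, h4]
    by_cases g1 : q = n
    · subst g1
      simp
    by_cases g2 : q = n + 1
    · subst g2
      simp
    by_cases g3 : q = n + 2
    · subst g3
      simp
    simp [g1, g2, g3]
  rw [e]
  exact ((hasSum_ite_eq n _).add (hasSum_ite_eq (n + 1) _)).add (hasSum_ite_eq (n + 2) _)

/-- Balance across each cut between `n` and `n + 1` makes `μ` geometric from level 1 on, with ratio
`ρ`. Summability forces `ρ < 1`, which is `l < s`, and the quotient equals `1 - ρ`. -/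
lemma IsStationary.queue (hl : 0 < l ∧ l < 1) (hs : 0 < s ∧ s < 1) {μ : ℕ → ℝ}
    (hμ : IsStationary (queueTrans l s) μ) :
    l < s ∧ μ 1 / (1 - μ 0) = (s - l) / ((1 - l) * s) := by
  obtain ⟨h0, h1, h2⟩ := hμ
  have hl' : 0 < 1 - l := by linarith
  have hs' : 0 < 1 - s := by linarith
  have hl0 := hl.1
  have hs0 := hs.1
  have cut (n : ℕ) : μ (n + 1) * (s * (1 - l)) = μ n * ((1 - if n = 0 then 0 else s) * l) := by
    induction n with
    | zero =>
      have := (h2 0).unique (hasSum_queueTrans_zero μ)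
      simp; linarith
    | succ n ih =>
      have := (h2 (n + 1)).unique (hasSum_queueTrans_succ μ n)
      rw [← ih] at this
      simp; linarith
  have hd : 0 < s * (1 - l) := mul_pos hs0 hl'
  obtain ⟨ρ, hρ⟩ : ∃ ρ, ρ = (1 - s) * l / (s * (1 - l)) := ⟨_, rfl⟩
  have hρ0 : 0 < ρ := by rw [hρ]; positivity
  have geo (n : ℕ) : μ (n + 1) = μ 1 * ρ ^ n := by
    induction n with
    | zero => simp
    | succ n ih =>
      have := cut (n + 1)
      simp only [Nat.add_eq_zero_iff, one_ne_zero, and_false, if_false] at this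
      rw [pow_succ, ← mul_assoc, ← ih, hρ, ← mul_div_assoc, eq_div_iff hd.ne', this]
  have cut0 := cut 0
  simp only [zero_add, if_true, sub_zero, one_mul] at cut0
  have hshift : HasSum (fun n => μ 1 * ρ ^ n) (1 - μ 0) := by
    have : HasSum (fun n => μ (n + 1)) (1 - μ 0) := by simpa using (hasSum_nat_add_iff' 1).2 h1
    rwa [funext geo] at this
  have hμ1 : μ 1 ≠ 0 := by
    intro h
    rw [h, zero_mul] at cut0
    have h3 : μ 0 = 0 := by
      rcases mul_eq_zero.1 cut0.symm with h | h
      · exact h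
      · exact absurd h hl0.ne'
    simp only [h, h3, zero_mul, sub_zero] at hshift
    exact zero_ne_one (hasSum_zero.unique hshift)
  have hρ1 : ρ < 1 := by
    have h3 : Summable fun n => ρ ^ n := (summable_mul_left_iff hμ1).1 hshift.summable
    have := summable_geometric_iff_norm_lt_one.1 h3
    rwa [Real.norm_of_nonneg hρ0.le] at this
  have hsum := hshift.unique ((hasSum_geometric_of_lt_one hρ0.le hρ1).mul_left (μ 1))
  have hρ1' : 0 < 1 - ρ := by linarith
  constructor
  · rw [hρ, div_lt_one hd] at hρ1
    linarith
  · rw [hsum]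
    have : (s - l) / ((1 - l) * s) = 1 - ρ := by
      rw [hρ]; field_simp; ring
    rw [this]
    field_simp

lemma exists_isStationary_queue (hl : 0 < l ∧ l < 1) (hs : 0 < s ∧ s < 1) (h : l < s) :
    ∃ μ, IsStationary (queueTrans l s) μ := by
  have hl' : 0 < 1 - l := by linarith
  have hs' : 0 < 1 - s := by linarith
  have hl0 := hl.1
  have hs0 := hs.1
  have hd : 0 < s * (1 - l) := mul_pos hs0 hl'
  obtain ⟨ρ, hρ⟩ : ∃ ρ, ρ = (1 - s) * l / (s * (1 - l)) := ⟨_, rfl⟩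
  have hρ0 : 0 < ρ := by rw [hρ]; positivity
  have hρ1 : ρ < 1 := by rw [hρ, div_lt_one hd]; linarith
  have hρd : ρ * (s * (1 - l)) = (1 - s) * l := by rw [hρ]; field_simp
  obtain ⟨b, hb⟩ : ∃ b, b = l / s * (1 - ρ) := ⟨_, rfl⟩
  have hls : 0 < 1 - l / s := by rw [sub_pos, div_lt_one hs0]; exact h
  have hρs : s * (1 - l) * (1 - ρ) = s - l := by linear_combination -hρd
  -- The busy probability is `l / s`, since throughput equals the arrival rate.
  refine ⟨fun n => if n = 0 then 1 - l / s else b * ρ ^ (n - 1), fun n => ?_, ?_, fun n => ?_⟩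
  · have : 0 < 1 - ρ := by linarith
    simp only
    split_ifs
    · exact hls.le
    · rw [hb]; positivity
  · rw [← hasSum_nat_add_iff' 1]
    have := (hasSum_geometric_of_lt_one hρ0.le hρ1).mul_left b
    have e : b * (1 - ρ)⁻¹ = l / s := by
      have : 1 - ρ ≠ 0 := by linarith
      rw [hb]; field_simp
    rw [e] at this
    simpa using this
  · have e1 : (1 - l / s) * l = b * (s * (1 - l)) := by
      rw [hb]
      have : l / s * (1 - ρ) * (s * (1 - l)) = l / s * (s * (1 - l) * (1 - ρ)) := by ring
      rw [this, hρs]; field_simp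
    rcases n with _ | _ | n
    · convert hasSum_queueTrans_zero _ using 1
      simp; linarith
    · convert hasSum_queueTrans_succ _ 0 using 1
      simp
      linear_combination -e1 - b * hρd
    · convert hasSum_queueTrans_succ _ (n + 1) using 1
      simp [pow_succ]
      linear_combination (b * ρ ^ n) * ((1 - ρ) * hρd)

end Queue

/-! ### The approximate model for two nodes without backoff -/

section Two

variable {i j : Fin 2}

lemma sum_fin_two_of_ne {M : Type*} [AddCommMonoid M] (hji : j ≠ i) (f : Fin 2 → M) :
    ∑ k, f k = f i + f j := by
  rw [Fin.sum_univ_two]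
  fin_cases i <;> fin_cases j <;> simp_all [add_comm]

lemma prod_fin_two_of_ne {M : Type*} [CommMonoid M] (hji : j ≠ i) (f : Fin 2 → M) :
    ∏ k, f k = f i * f j := by
  rw [Fin.prod_univ_two]
  fin_cases i <;> fin_cases j <;> simp_all [mul_comm]

lemma prod_ne_fin_two {M : Type*} [CommMonoid M] (hji : j ≠ i) (f : {k : Fin 2 // k ≠ i} → M) :
    ∏ k, f k = f ⟨j, hji⟩ := by
  have : Subsingleton {k : Fin 2 // k ≠ i} := ⟨fun a b => Subtype.ext (by omega)⟩
  exact Fintype.prod_subsingleton f ⟨j, hji⟩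

lemma sum_bool_vectors {M : Type*} [AddCommMonoid M] (hji : j ≠ i) (f : (Fin 2 → Bool) → M) :
    ∑ a, f a = f (fun _ => false) + f (single i) + f (single j) + f (fun _ => true) := by
  have e0 : (fun _ => false : Fin 2 → Bool) = ![false, false] := by decide
  have e1 : (fun _ => true : Fin 2 → Bool) = ![true, true] := by decide
  rw [sum_bool_pairs, e0, e1]
  have : i = 0 ∧ j = 1 ∨ i = 1 ∧ j = 0 := by omega
  rcases this with ⟨rfl, rfl⟩ | ⟨rfl, rfl⟩
  · rw [single_zero_eq, single_one_eq]
  · rw [single_zero_eq, single_one_eq]; abel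

lemma weight_false : weight (fun _ => false : Fin 2 → Bool) = 0 := by decide
lemma weight_true : weight (fun _ => true : Fin 2 → Bool) = 2 := by decide
lemma weight_single (k : Fin 2) : weight (single k) = 1 := by revert k; decide
lemma single_self (k : Fin 2) : single k k = true := by simp [single]
lemma single_of_ne (hji : j ≠ i) : single i j = false := by simp [single, hji]
lemma single_ne_false (k : Fin 2) : ¬ single k = fun _ => false := by revert k; decide
lemma false_ne_single (k : Fin 2) : ¬ (fun _ => false) = single k := by revert k; decide
lemma single_ne_single (hji : j ≠ i) : ¬ single i = single j := by
  revert i j; decide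
lemma true_ne_single (k : Fin 2) : ¬ (fun _ => true) = single k := by revert k; decide

/-- The phase of the chain of node `i` in which the other queue is non-empty iff `u`. -/
def phaseOf (i : Fin 2) (u : Bool) : Phase 2 0 i :=
  ⟨(fun _ => 0, fun _ => u), fun _ _ => Subsingleton.elim _ _⟩

/-- Without backoff, a phase is the indicator of the other queue. -/
def phaseEquiv (hji : j ≠ i) : Bool ≃ Phase 2 0 i where
  toFun := phaseOf i
  invFun h := h.1.2 ⟨j, hji⟩
  left_inv _ := rfl
  right_inv h := by
    have : Subsingleton {k : Fin 2 // k ≠ i} := ⟨fun a b => Subtype.ext (by omega)⟩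
    refine Subtype.ext (Prod.ext (funext fun _ => Subsingleton.elim _ _) (funext fun k => ?_))
    rw [Subsingleton.elim k ⟨j, hji⟩]; rfl

/-- Without backoff, a state is a queue length and the indicator of the other queue. -/
def qbdEquiv (hji : j ≠ i) : ℕ × Bool ≃ QBDState 2 0 i where
  toFun s := ⟨(s.1, phaseEquiv hji s.2), fun _ => Subsingleton.elim _ _⟩
  invFun s := (s.1.1, (phaseEquiv hji).symm s.1.2)
  left_inv _ := rfl
  right_inv _ := Subtype.ext (Prod.ext rfl ((phaseEquiv hji).apply_symm_apply _))

/-- Success probability of a node with attempt probability `p` and a packet iff `u`, when the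
other node has attempt probability `q` and a packet iff `v`. -/
noncomputable def successBool (p q : ℝ) (u v : Bool) : ℝ :=
  if u then p * (if v then 1 - q else 1) else 0

lemma qbdTrans_eq (hji : j ≠ i) (p lam z : Fin 2 → ℝ) (r : ℝ) (q q' : ℕ) (u u' : Bool) :
    qbdTrans p r lam z i q (phaseEquiv hji u) q' (phaseEquiv hji u') =
      (1 - successBool (p i) (p j) (decide (0 < q)) u - successBool (p j) (p i) u (decide (0 < q))) *
          (arrivalProb (lam i) ((q' : ℤ) - q) *
            indicatorProb (lam j) u u' (u'.toInt - u.toInt)) +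
        successBool (p i) (p j) (decide (0 < q)) u *
          (arrivalProb (lam i) ((q' : ℤ) - q + 1) *
            indicatorProb (lam j) u u' (u'.toInt - u.toInt)) +
        successBool (p j) (p i) u (decide (0 < q)) *
          (arrivalProb (lam i) ((q' : ℤ) - q) *
            (z j * indicatorProb (lam j) u u' (u'.toInt - u.toInt + 1) +
              (1 - z j) * indicatorProb (lam j) u u' (u'.toInt - u.toInt))) := by
  have hK (b : Fin 2 → Fin (0 + 1)) (a : Fin 2 → Bool) (b' : Fin 2 → Fin (0 + 1)) :
      (nextBackoff b a = b') = True := by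
    simp only [eq_iff_iff, iff_true]; exact Subsingleton.elim _ _
  have hB (b : Fin (0 + 1)) : (b : ℕ) = 0 := by omega
  have hij := hji.symm
  have hu (u : Bool) (k) : (phaseEquiv hji u).1.2 k = u := rfl
  have hbi (u : Bool) : busyVec i q (phaseEquiv hji u) i = decide (0 < q) := by simp [busyVec]
  have hbj (u : Bool) : busyVec i q (phaseEquiv hji u) j = u := by
    simp [busyVec, hji, hu]
  simp only [qbdTrans, queueProb, decrementProb, Finset.sum_filter, sum_bool_vectors hji, hK,
    if_true, attemptProb, prod_fin_two_of_ne hji, prod_ne_fin_two hji, sum_fin_two_of_ne hji,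
    weight_false, weight_true, weight_single, single_self, single_of_ne hji, single_of_ne hij,
    single_ne_false, false_ne_single, single_ne_single hji, single_ne_single hij,
    true_ne_single, hbi, hbj, hu, hB, pow_zero, div_one]
  rcases Nat.eq_zero_or_pos q with h | h <;> cases u <;>
    simp [h, hji, successBool, -mul_eq_mul_left_iff] <;> ring

/-- In a saturated regime the queue of node `j` moves like `queueTrans`. -/
lemma qbdTrans_saturated (hij : i ≠ j) (p lam z : Fin 2 → ℝ) (r : ℝ) (hz : z i = 0) (q q' : ℕ)
    (u' : Bool) :
    qbdTrans p r lam z j q (phaseEquiv hij true) q' (phaseEquiv hij u') =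
      if u' then queueTrans (lam j) (p j * (1 - p i)) q q' else 0 := by
  rw [qbdTrans_eq, hz]
  rcases q with _ | q <;> cases u' <;> simp [successBool, indicatorProb, queueTrans] <;> ring

/-- With `z i = 0` a success never empties node `i`, so the states with node `i` non-empty form a
closed set. Balance at the other states is trivial, and only the queue of node `j` remains. -/
lemma isSaturatedStationary_iff (hij : i ≠ j) (p lam z : Fin 2 → ℝ) (r : ℝ) (hz : z i = 0)
    (π : QBDState 2 0 j → ℝ) :
    IsSaturatedStationary p r lam z i j hij π ↔ (∀ q, π (qbdEquiv hij (q, false)) = 0) ∧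
      IsStationary (queueTrans (lam j) (p j * (1 - p i))) fun q => π (qbdEquiv hij (q, true)) := by
  have hinj : Function.Injective fun q : ℕ => (q, true) := fun a b h => congrArg Prod.fst h
  have hrange {f : ℕ × Bool → ℝ} (hf : ∀ q, f (q, false) = 0) :
      ∀ s, s ∉ Set.range (fun q : ℕ => (q, true)) → f s = 0 := by
    rintro ⟨q, u⟩ h
    cases u
    · exact hf q
    · exact absurd ⟨q, rfl⟩ h
  have hsum {f : QBDState 2 0 j → ℝ} {a : ℝ} (hf : ∀ q, f (qbdEquiv hij (q, false)) = 0) :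
      HasSum f a ↔ HasSum (fun q => f (qbdEquiv hij (q, true))) a := by
    rw [← (qbdEquiv hij).hasSum_iff, ← hinj.hasSum_iff (hrange fun q => hf q)]
    rfl
  have hq (q q' : ℕ) (u' : Bool) := qbdTrans_saturated hij p lam z r hz q q' u'
  unfold IsSaturatedStationary
  constructor
  · rintro ⟨⟨h0, h1, h2⟩, h3⟩
    have h4 (q) : π (qbdEquiv hij (q, false)) = 0 := h3 _ rfl
    refine ⟨h4, fun q => h0 _, (hsum h4).1 h1, fun t => ?_⟩
    have := (hsum fun q => by simp [h4]).1 (h2 (qbdEquiv hij (t, true)))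
    refine this.congr_fun ?_
    intro q
    exact congrArg _ (hq q t true).symm
  · rintro ⟨h4, h0, h1, h2⟩
    have h3 (s : QBDState 2 0 j) (hs : s.1.2.1.2 ⟨i, hij⟩ = false) : π s = 0 := by
      obtain ⟨⟨q, u⟩, rfl⟩ := (qbdEquiv hij).surjective s
      have : u = false := hs
      rw [this]; exact h4 q
    refine ⟨⟨fun s => ?_, (hsum h4).2 h1, fun t => ?_⟩, h3⟩
    · obtain ⟨⟨q, u⟩, rfl⟩ := (qbdEquiv hij).surjective s
      cases u
      · exact (h4 q).ge
      · exact h0 q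
    · obtain ⟨⟨t, u⟩, rfl⟩ := (qbdEquiv hij).surjective t
      refine (hsum fun q => by simp [h4]).2 ?_
      have e (q : ℕ) : qbdTrans p r lam z j (qbdEquiv hij (q, true)).1.1
          (qbdEquiv hij (q, true)).1.2 (qbdEquiv hij (t, u)).1.1 (qbdEquiv hij (t, u)).1.2 = _ :=
        hq q t u
      simp only [e]
      cases u
      · simp [h4]
      · exact h2 t

lemma levelMass_eq (hij : i ≠ j) {π : QBDState 2 0 j → ℝ}
    (h : ∀ q, π (qbdEquiv hij (q, false)) = 0) (l : ℕ) :
    levelMass π l = π (qbdEquiv hij (l, true)) := by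
  unfold levelMass
  rw [← (qbdEquiv hij).tsum_eq, tsum_eq_single (l, true)]
  · exact if_pos rfl
  · rintro ⟨q, u⟩ hne
    cases u
    · simp [h]
    · refine if_neg fun h' => hne ?_
      have : q = l := h'
      rw [this]

lemma forall_ne_fin_two {P : ∀ k : Fin 2, i ≠ k → Prop} (hij : i ≠ j) :
    (∀ k (h : i ≠ k), P k h) ↔ P j hij := by
  refine ⟨fun h => h j hij, fun h k hk => ?_⟩
  have : k = j := by omega
  subst this
  exact h

section

variable {p lam : Fin 2 → ℝ} (r : ℝ)

lemma exists_isSaturatedStationary_iff (hp : ∀ k, 0 < p k ∧ p k < 1)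
    (hl : ∀ k, 0 < lam k ∧ lam k < 1) (hij : i ≠ j) {z : Fin 2 → ℝ} (hz : z i = 0) :
    (∃ π : QBDState 2 0 j → ℝ, IsSaturatedStationary p r lam z i j hij π) ↔
      lam j < p j * (1 - p i) := by
  have hs : 0 < p j * (1 - p i) ∧ p j * (1 - p i) < 1 := by
    have := mul_pos (hp j).1 (hp i).1
    exact ⟨mul_pos (hp j).1 (by linarith [(hp i).2]), by linarith [(hp j).2]⟩
  constructor
  · rintro ⟨π, hπ⟩
    rw [isSaturatedStationary_iff hij p lam z r hz] at hπ
    exact (hπ.2.queue (hl j) hs).1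
  · intro h
    obtain ⟨μ, hμ⟩ := exists_isStationary_queue (hl j) hs h
    refine ⟨fun s => if ((qbdEquiv hij).symm s).2 then μ ((qbdEquiv hij).symm s).1 else 0, ?_⟩
    rw [isSaturatedStationary_iff hij p lam z r hz]
    simpa using hμ

/-- The chain of node `j` restricted to the closed set depends on `z` only through `z i = 0`, so the
defining condition is an explicit formula for `z j` and not a fixed-point equation. -/
lemma isSaturatedZ_iff_of_lt (hp : ∀ k, 0 < p k ∧ p k < 1) (hl : ∀ k, 0 < lam k ∧ lam k < 1)
    (hij : i ≠ j) (h : lam j < p j * (1 - p i)) (z : Fin 2 → ℝ) :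
    IsSaturatedZ 0 p r lam i z ↔
      z i = 0 ∧ z j = (p j * (1 - p i) - lam j) / ((1 - lam j) * p j * (1 - p i)) := by
  have hs : 0 < p j * (1 - p i) ∧ p j * (1 - p i) < 1 := by
    have := mul_pos (hp j).1 (hp i).1
    exact ⟨mul_pos (hp j).1 (by linarith [(hp i).2]), by linarith [(hp j).2]⟩
  unfold IsSaturatedZ
  rw [forall_ne_fin_two hij, mul_assoc]
  refine and_congr_right fun hz => ?_
  have hex := (exists_isSaturatedStationary_iff r hp hl hij hz).2 h
  have hval {π : QBDState 2 0 j → ℝ} (hπ : IsSaturatedStationary p r lam z i j hij π) :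
      levelMass π 1 / (1 - levelMass π 0) =
        (p j * (1 - p i) - lam j) / ((1 - lam j) * (p j * (1 - p i))) := by
    rw [isSaturatedStationary_iff hij p lam z r hz] at hπ
    rw [levelMass_eq hij hπ.1, levelMass_eq hij hπ.1]
    exact (hπ.2.queue (hl j) hs).2
  constructor
  · rintro (⟨π, hπ, e⟩ | ⟨h', -⟩)
    · rw [e, hval hπ]
    · exact absurd hex h'
  · intro e
    obtain ⟨π, hπ⟩ := hex
    exact Or.inl ⟨π, hπ, by rw [e, hval hπ]⟩

lemma isSaturatedZ_iff_of_le (hp : ∀ k, 0 < p k ∧ p k < 1) (hl : ∀ k, 0 < lam k ∧ lam k < 1)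
    (hij : i ≠ j) (h : p j * (1 - p i) ≤ lam j) (z : Fin 2 → ℝ) :
    IsSaturatedZ 0 p r lam i z ↔ z i = 0 ∧ z j = 0 := by
  unfold IsSaturatedZ
  rw [forall_ne_fin_two hij]
  refine and_congr_right fun hz => ?_
  have hex : ¬ ∃ π : QBDState 2 0 j → ℝ, IsSaturatedStationary p r lam z i j hij π := fun h' =>
    ((exists_isSaturatedStationary_iff r hp hl hij hz).1 h').not_ge h
  constructor
  · rintro (⟨π, hπ, -⟩ | ⟨-, e⟩)
    · exact absurd ⟨π, hπ⟩ hex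
    · exact e
  · exact fun e => Or.inr ⟨hex, e⟩

/-- The other queue becomes empty only by a success with its last packet, followed by no arrival;
the level changes of node `i` sum out. -/
lemma phaseMatrix_eq (hji : j ≠ i) (p lam z : Fin 2 → ℝ) (r : ℝ) (u u' : Bool) :
    phaseMatrix p r lam z i (phaseEquiv hji u) (phaseEquiv hji u') =
      if u then (if u' then 1 - p j * (1 - p i) * z j * (1 - lam j)
        else p j * (1 - p i) * z j * (1 - lam j)) else (if u' then lam j else 1 - lam j) := by
  simp only [phaseMatrix, qbdTrans_eq]
  cases u <;> cases u' <;> simp [successBool, indicatorProb, arrivalProb] <;> ring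

lemma successProb_eq (hji : j ≠ i) (p : Fin 2 → ℝ) (r : ℝ) (u : Bool) :
    successProb p r i (phaseEquiv hji u) = p i * (if u then 1 - p j else 1) := by
  have hij := hji.symm
  have hB (b : Fin (0 + 1)) : (b : ℕ) = 0 := by omega
  have hu (u : Bool) (k) : (phaseEquiv hji u).1.2 k = u := rfl
  simp only [successProb, attemptProb, prod_fin_two_of_ne hji, single_self, single_of_ne hji, hB]
  cases u <;> simp [busyVec, hji, hu]

/-- The stationary probability vectors of the phase process. -/
lemma isStationary_phaseMatrix_iff (hji : j ≠ i) (p lam z : Fin 2 → ℝ) (r : ℝ)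
    (α : Phase 2 0 i → ℝ) :
    IsStationary (phaseMatrix p r lam z i) α ↔
      0 ≤ α (phaseEquiv hji false) ∧ 0 ≤ α (phaseEquiv hji true) ∧
      α (phaseEquiv hji false) + α (phaseEquiv hji true) = 1 ∧
      α (phaseEquiv hji false) * lam j =
        α (phaseEquiv hji true) * (p j * (1 - p i) * z j * (1 - lam j)) := by
  have hs (f : Phase 2 0 i → ℝ) (a : ℝ) :
      HasSum f a ↔ f (phaseEquiv hji false) + f (phaseEquiv hji true) = a := by
    rw [← (phaseEquiv hji).hasSum_iff]
    have := hasSum_fintype (f ∘ phaseEquiv hji)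
    rw [Fintype.sum_bool] at this
    simp only [Function.comp_apply] at this
    rw [add_comm]
    exact ⟨fun h => this.unique h, fun h => h ▸ this⟩
  have hall (P : Phase 2 0 i → Prop) :
      (∀ h, P h) ↔ P (phaseEquiv hji false) ∧ P (phaseEquiv hji true) := by
    rw [← (phaseEquiv hji).forall_congr_right, Bool.forall_bool]
  simp only [IsStationary, hs, hall, phaseMatrix_eq]
  constructor
  · rintro ⟨⟨h0, h1⟩, h2, h3, h4⟩
    refine ⟨h0, h1, h2, ?_⟩
    simp at h3; linarith
  · rintro ⟨h0, h1, h2, h3⟩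
    refine ⟨⟨h0, h1⟩, h2, ?_, ?_⟩ <;> simp <;> linarith

lemma sum_successProb (hji : j ≠ i) (p : Fin 2 → ℝ) (r : ℝ) (α : Phase 2 0 i → ℝ) :
    ∑ h, α h * successProb p r i h =
      α (phaseEquiv hji false) * p i + α (phaseEquiv hji true) * (p i * (1 - p j)) := by
  rw [← (phaseEquiv hji).sum_comp, Fintype.sum_bool, successProb_eq, successProb_eq]
  simp; ring

end
end Two

/-! ### Critical rates and the region of the model -/

section

variable {p lam : Fin 2 → ℝ} (r : ℝ) {i j : Fin 2}

lemma isStationary_phaseMatrix_iff_of_lt (hp : ∀ k, 0 < p k ∧ p k < 1)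
    (hl : ∀ k, 0 < lam k ∧ lam k < 1) (hji : j ≠ i) (h : lam j < p j * (1 - p i)) {z : Fin 2 → ℝ}
    (hz : z j = (p j * (1 - p i) - lam j) / ((1 - lam j) * p j * (1 - p i)))
    (α : Phase 2 0 i → ℝ) :
    IsStationary (phaseMatrix p r lam z i) α ↔
      ∀ h, α h = if h.1.2 ⟨j, hji⟩ = false then 1 - lam j / (p j * (1 - p i))
        else lam j / (p j * (1 - p i)) := by
  have hp' : 0 < 1 - p i := by linarith [(hp i).2]
  have hl' : 0 < 1 - lam j := by linarith [(hl j).2]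
  have hpj := (hp j).1
  have hlj := (hl j).1
  have hs : 0 < p j * (1 - p i) := mul_pos hpj hp'
  -- The rate of leaving the non-empty phase becomes `s - lam j` with `s = p j * (1 - p i)`, while
  -- that of entering it is `lam j`; so the non-empty phase has weight `lam j / s`.
  have e : p j * (1 - p i) * z j * (1 - lam j) = p j * (1 - p i) - lam j := by
    rw [hz]; field_simp
  have hf (u : Bool) : (phaseEquiv hji u).1.2 ⟨j, hji⟩ = u := rfl
  rw [isStationary_phaseMatrix_iff hji, e, ← (phaseEquiv hji).forall_congr_right, Bool.forall_bool,
    hf, hf]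
  simp only [if_true, Bool.true_eq_false, if_false]
  have hlt : lam j / (p j * (1 - p i)) < 1 := (div_lt_one hs).2 h
  have hpos : 0 < lam j / (p j * (1 - p i)) := div_pos hlj hs
  constructor
  · rintro ⟨-, -, h1, h2⟩
    have h3 : α (phaseEquiv hji true) = lam j / (p j * (1 - p i)) := by
      rw [eq_div_iff hs.ne']
      linear_combination lam j * h1 - h2
    exact ⟨by linarith, h3⟩
  · rintro ⟨h1, h2⟩
    rw [h1, h2]
    refine ⟨by linarith, hpos.le, by ring, ?_⟩
    field_simp

lemma isCriticalRate_iff_of_lt (hp : ∀ k, 0 < p k ∧ p k < 1)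
    (hl : ∀ k, 0 < lam k ∧ lam k < 1) (hji : j ≠ i) (h : lam j < p j * (1 - p i)) (v : ℝ) :
    IsCriticalRate 0 p r lam i v ↔ v = p i * (1 - lam j / (1 - p i)) := by
  have hp' : 0 < 1 - p i := by linarith [(hp i).2]
  have hpj := (hp j).1
  have hs : 0 < p j * (1 - p i) := mul_pos hpj hp'
  have hf (u : Bool) : (phaseEquiv hji u).1.2 ⟨j, hji⟩ = u := rfl
  have hval (α : Phase 2 0 i → ℝ) (hα : ∀ h, α h = if h.1.2 ⟨j, hji⟩ = false then
      1 - lam j / (p j * (1 - p i)) else lam j / (p j * (1 - p i))) :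
      ∑ h, α h * successProb p r i h = p i * (1 - lam j / (1 - p i)) := by
    rw [sum_successProb hji, hα, hα, hf, hf]
    simp only [if_true, Bool.true_eq_false, if_false]
    field_simp
    ring
  constructor
  · rintro ⟨z, α, hz, hα, rfl⟩
    rw [isSaturatedZ_iff_of_lt r hp hl hji.symm h] at hz
    exact hval α ((isStationary_phaseMatrix_iff_of_lt r hp hl hji h hz.2 α).1 hα)
  · rintro rfl
    have hz : IsSaturatedZ 0 p r lam i (fun k => if k = i then 0 else
        (p j * (1 - p i) - lam j) / ((1 - lam j) * p j * (1 - p i))) :=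
      (isSaturatedZ_iff_of_lt r hp hl hji.symm h _).2 ⟨by simp, by simp [hji]⟩
    refine ⟨_, fun h => if h.1.2 ⟨j, hji⟩ = false then
      1 - lam j / (p j * (1 - p i)) else lam j / (p j * (1 - p i)), hz, ?_, ?_⟩
    · exact (isStationary_phaseMatrix_iff_of_lt r hp hl hji h (by simp [hji]) _).2 fun h => rfl
    · exact (hval _ fun h => rfl).symm

/-- With `z j = 0` the non-empty phase is absorbing and `α` is concentrated there. -/
lemma isCriticalRate_iff_of_le (hp : ∀ k, 0 < p k ∧ p k < 1)
    (hl : ∀ k, 0 < lam k ∧ lam k < 1) (hji : j ≠ i) (h : p j * (1 - p i) ≤ lam j) (v : ℝ) :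
    IsCriticalRate 0 p r lam i v ↔ v = p i * (1 - p j) := by
  have hst (z : Fin 2 → ℝ) (hz : z j = 0) (α : Phase 2 0 i → ℝ) :
      IsStationary (phaseMatrix p r lam z i) α ↔
        α (phaseEquiv hji false) = 0 ∧ α (phaseEquiv hji true) = 1 := by
    rw [isStationary_phaseMatrix_iff hji, hz]
    simp only [mul_zero, zero_mul, mul_eq_zero, (hl j).1.ne', or_false]
    constructor
    · rintro ⟨-, -, h1, h2⟩
      exact ⟨h2, by linarith⟩
    · rintro ⟨h1, h2⟩
      rw [h1, h2]
      norm_num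
  constructor
  · rintro ⟨z, α, hz, hα, rfl⟩
    rw [isSaturatedZ_iff_of_le r hp hl hji.symm h] at hz
    obtain ⟨h1, h2⟩ := (hst z hz.2 α).1 hα
    rw [sum_successProb hji, h1, h2]; ring
  · rintro rfl
    refine ⟨fun _ => 0, fun h => if h.1.2 ⟨j, hji⟩ then 1 else 0,
      (isSaturatedZ_iff_of_le r hp hl hji.symm h _).2 ⟨rfl, rfl⟩, (hst _ rfl _).2 ⟨rfl, rfl⟩, ?_⟩
    rw [sum_successProb hji]
    have hf (u : Bool) : (phaseEquiv hji u).1.2 ⟨j, hji⟩ = u := rfl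
    simp [hf]

lemma mem_modelRegion_iff (hp : ∀ k, 0 < p k ∧ p k < 1) (hl : ∀ k, 0 < lam k ∧ lam k < 1) :
    lam ∈ modelRegion 0 p r ↔
      ((lam 1 < p 1 * (1 - p 0) ∧ lam 0 < p 0 * (1 - lam 1 / (1 - p 0))) ∨
        (lam 0 < p 0 * (1 - p 1) ∧ lam 1 < p 1 * (1 - lam 0 / (1 - p 1)))) := by
  have hmem : lam ∈ modelRegion 0 p r ↔ (∃ v, IsCriticalRate 0 p r lam 0 v ∧ lam 0 < v) ∧
      ∃ v, IsCriticalRate 0 p r lam 1 v ∧ lam 1 < v := by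
    rw [← Fin.forall_fin_two (p := fun i => ∃ v, IsCriticalRate 0 p r lam i v ∧ lam i < v)]
    exact ⟨fun h => h.2, fun h => ⟨hl, h⟩⟩
  have hlt (i j : Fin 2) (hji : j ≠ i) (h : lam j < p j * (1 - p i)) :
      (∃ v, IsCriticalRate 0 p r lam i v ∧ lam i < v) ↔ lam i < p i * (1 - lam j / (1 - p i)) := by
    simp [isCriticalRate_iff_of_lt r hp hl hji h]
  have hle (i j : Fin 2) (hji : j ≠ i) (h : p j * (1 - p i) ≤ lam j) :
      (∃ v, IsCriticalRate 0 p r lam i v ∧ lam i < v) ↔ lam i < p i * (1 - p j) := by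
    simp [isCriticalRate_iff_of_le r hp hl hji h]
  -- The critical rate against an unsaturated competitor exceeds the one against a saturated one.
  -- Hence both conditions hold automatically when both rates are below their saturated service
  -- rates.
  have hauto (i j : Fin 2) (h : lam j < p j * (1 - p i)) :
      p i * (1 - p j) < p i * (1 - lam j / (1 - p i)) := by
    have hp' : 0 < 1 - p i := by linarith [(hp i).2]
    have := (div_lt_iff₀ hp').2 h
    exact mul_lt_mul_of_pos_left (by linarith) (hp i).1
  rw [hmem]
  rcases lt_or_ge (lam 1) (p 1 * (1 - p 0)) with h1 | h1 <;>
    rcases lt_or_ge (lam 0) (p 0 * (1 - p 1)) with h0 | h0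
  · rw [hlt 0 1 (by decide) h1, hlt 1 0 (by decide) h0]
    have := hauto 0 1 h1
    have := hauto 1 0 h0
    exact ⟨fun h => Or.inl ⟨h1, h.1⟩, fun _ => ⟨by linarith, by linarith⟩⟩
  · rw [hlt 0 1 (by decide) h1, hle 1 0 (by decide) h0]
    exact ⟨fun h => Or.inl ⟨h1, h.1⟩, fun h => ⟨h.elim And.right fun h => absurd h.1 h0.not_gt, h1⟩⟩
  · rw [hle 0 1 (by decide) h1, hlt 1 0 (by decide) h0]
    exact ⟨fun h => Or.inr ⟨h0, h.2⟩, fun h => ⟨h0, h.elim (fun h => absurd h.1 h1.not_gt) And.right⟩⟩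
  · rw [hle 0 1 (by decide) h1, hle 1 0 (by decide) h0]
    exact ⟨fun h => absurd h.1 h0.not_gt,
      fun h => h.elim (fun h => absurd h.1 h1.not_gt) fun h => absurd h.1 h0.not_gt⟩

end

/-! ### Comparison with the two linear constraints -/

/-- Inside the first half of the Rao–Ephremides region, the second linear constraint is automatic
if the attempt probabilities sum up to at most `1`. -/
lemma linear_constraint_of_add_le_one {p q l m : ℝ} (hp : 0 < p ∧ p < 1) (hq : 0 < q ∧ q < 1)
    (hpq : p + q ≤ 1) (h1 : m < q * (1 - p)) (h2 : l < p * (1 - m / (1 - p))) :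
    m < q * (1 - l / (1 - q)) := by
  have hp' : 0 < 1 - p := by linarith
  have hq' : 0 < 1 - q := by linarith
  have h3 : l * (1 - p) < p * (1 - p - m) := by
    have := mul_lt_mul_of_pos_right h2 hp'
    have e : p * (1 - m / (1 - p)) * (1 - p) = p * (1 - p - m) := by field_simp
    linarith
  have e : q * (1 - l / (1 - q)) - m =
      (q * (1 - q) * (1 - p) - q * (l * (1 - p)) - m * (1 - q) * (1 - p)) /
        ((1 - q) * (1 - p)) := by
    field_simp
  rw [← sub_pos, e]
  refine div_pos ?_ (mul_pos hq' hp')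
  have h4 : q * (l * (1 - p)) < q * (p * (1 - p - m)) := mul_lt_mul_of_pos_left h3 hq.1
  -- This product is the numerator when `l` is replaced by its upper bound.
  have h5 : 0 ≤ (1 - p - q) * (q * (1 - p) - m) := mul_nonneg (by linarith) (by linarith)
  linarith

/-- If the attempt probabilities sum up to more than `1`, then a point of the Rao–Ephremides region
violates one of the linear constraints. -/
lemma exists_linear_constraint_fails {p q : ℝ} (hp : 0 < p ∧ p < 1) (hq : 0 < q ∧ q < 1)
    (hpq : 1 < p + q) : ∃ l m : ℝ, (0 < l ∧ l < 1) ∧ (0 < m ∧ m < 1) ∧ m < q * (1 - p) ∧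
      l < p * (1 - m / (1 - p)) ∧ ¬ m < q * (1 - l / (1 - q)) := by
  have hp' : 0 < 1 - p := by linarith
  have hq' : 0 < 1 - q := by linarith
  have hp0 := hp.1
  have hq0 := hq.1
  have hs : 0 < q * (1 - p) := mul_pos hq0 hp'
  have hlt : 0 < p + q - 1 := by linarith
  obtain ⟨e, he0, he1, he2⟩ : ∃ e : ℝ, 0 < e ∧ e < q ∧ p * e < p + q - 1 := by
    refine ⟨min (q / 2) ((p + q - 1) / 2), by positivity,
      (min_le_left _ _).trans_lt (by linarith), ?_⟩
    have := min_le_right (q / 2) ((p + q - 1) / 2)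
    have h0 : 0 < min (q / 2) ((p + q - 1) / 2) := by positivity
    nlinarith
  -- At `l = 1 - q` the bound on `m` in the second constraint is 0, so any positive `m` violates it.
  -- Since `1 - q < p`, the first half of the region still contains such points with small `m`.
  refine ⟨1 - q, e * (1 - p), ⟨hq', by linarith⟩, ⟨by positivity, ?_⟩, ?_, ?_, ?_⟩
  · nlinarith
  · exact mul_lt_mul_of_pos_right he1 hp'
  · rw [mul_div_cancel_right₀ _ hp'.ne']
    linarith
  · rw [div_self hq'.ne', sub_self, mul_zero]
    exact not_lt.2 (by positivity)

end Aloha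

theorem mainTheorem4 (p : Fin 2 → ℝ) (r : ℝ) (hp : ∀ k, 0 < p k ∧ p k < 1) (hr : 1 ≤ r) :
    (∀ lam : Fin 2 → ℝ, (∀ k, 0 < lam k ∧ lam k < 1) → ∀ (i j : Fin 2) (hji : j ≠ i),
      (lam j < p j * (1 - p i) →
        (∀ z : Fin 2 → ℝ, Aloha.IsSaturatedZ 0 p r lam i z ↔
          z i = 0 ∧ z j = (p j * (1 - p i) - lam j) / ((1 - lam j) * p j * (1 - p i))) ∧
        (∀ z : Fin 2 → ℝ, Aloha.IsSaturatedZ 0 p r lam i z →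
          ∀ α : Aloha.Phase 2 0 i → ℝ,
            Aloha.IsStationary (Aloha.phaseMatrix p r lam z i) α ↔
              ∀ h, α h = if h.1.2 ⟨j, hji⟩ = false then 1 - lam j / (p j * (1 - p i))
                else lam j / (p j * (1 - p i))) ∧
        (∀ v : ℝ, Aloha.IsCriticalRate 0 p r lam i v ↔ v = p i * (1 - lam j / (1 - p i)))) ∧
      (p j * (1 - p i) ≤ lam j →
        ∀ v : ℝ, Aloha.IsCriticalRate 0 p r lam i v ↔ v = p i * (1 - p j))) ∧
    Aloha.modelRegion 0 p r = Aloha.exactRegion 0 p r ∧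
    Aloha.modelRegion 0 p r =
      {lam | (∀ k, 0 < lam k ∧ lam k < 1) ∧
        ((lam 1 < p 1 * (1 - p 0) ∧ lam 0 < p 0 * (1 - lam 1 / (1 - p 0))) ∨
          (lam 0 < p 0 * (1 - p 1) ∧ lam 1 < p 1 * (1 - lam 0 / (1 - p 1))))} ∧
    (Aloha.modelRegion 0 p r =
      {lam | (∀ k, 0 < lam k ∧ lam k < 1) ∧
        lam 0 < p 0 * (1 - lam 1 / (1 - p 0)) ∧ lam 1 < p 1 * (1 - lam 0 / (1 - p 1))} ↔
      p 0 + p 1 ≤ 1) := by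
  have hregion : Aloha.modelRegion 0 p r =
      {lam | (∀ k, 0 < lam k ∧ lam k < 1) ∧
        ((lam 1 < p 1 * (1 - p 0) ∧ lam 0 < p 0 * (1 - lam 1 / (1 - p 0))) ∨
          (lam 0 < p 0 * (1 - p 1) ∧ lam 1 < p 1 * (1 - lam 0 / (1 - p 1))))} := by
    ext lam
    exact ⟨fun h => ⟨h.1, (Aloha.mem_modelRegion_iff r hp h.1).1 h⟩,
      fun h => (Aloha.mem_modelRegion_iff r hp h.1).2 h.2⟩
  refine ⟨fun lam hl i j hji => ⟨fun h => ⟨?_, ?_, ?_⟩, fun h => ?_⟩, ?_, hregion, ?_⟩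
  · exact Aloha.isSaturatedZ_iff_of_lt r hp hl hji.symm h
  · intro z hz
    have := ((Aloha.isSaturatedZ_iff_of_lt r hp hl hji.symm h z).1 hz).2
    exact Aloha.isStationary_phaseMatrix_iff_of_lt r hp hl hji h this
  · exact Aloha.isCriticalRate_iff_of_lt r hp hl hji h
  · exact Aloha.isCriticalRate_iff_of_le r hp hl hji h
  · ext lam
    exact ⟨fun h => (Aloha.mem_exactRegion_iff r hp lam h.1).2
        ((Aloha.mem_modelRegion_iff r hp h.1).1 h),
      fun h => (Aloha.mem_modelRegion_iff r hp h.1).2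
        ((Aloha.mem_exactRegion_iff r hp lam h.1).1 h)⟩
  · rw [hregion]
    constructor
    · intro h
      by_contra! hpq
      obtain ⟨l, m, hl, hm, h1, h2, h3⟩ :=
        Aloha.exists_linear_constraint_fails (hp 0) (hp 1) hpq
      have hmem := (Set.ext_iff.1 h ![l, m]).1
        ⟨Fin.forall_fin_two.2 ⟨hl, hm⟩, Or.inl ⟨h1, h2⟩⟩
      exact h3 hmem.2.2
    · intro hpq
      ext lam
      constructor
      · rintro ⟨hl, ⟨h1, h2⟩ | ⟨h1, h2⟩⟩
        · exact ⟨hl, h2, Aloha.linear_constraint_of_add_le_one (hp 0) (hp 1) hpq h1 h2⟩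
        · exact ⟨hl, Aloha.linear_constraint_of_add_le_one (hp 1) (hp 0)
            (by rwa [add_comm]) h1 h2, h2⟩
      · rintro ⟨hl, h1, h2⟩
        refine ⟨hl, ?_⟩
        rcases lt_or_ge (lam 1) (p 1 * (1 - p 0)) with h | h
        · exact Or.inl ⟨h, h1⟩
        · refine Or.inr ⟨h1.trans_le ?_, h2⟩
          have hp' : 0 < 1 - p 0 := by linarith [(hp 0).2]
          have := (le_div_iff₀ hp').2 h
          exact mul_le_mul_of_nonneg_left (by linarith) (hp 0).1.le
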